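/- Let $(M,g)$ be an oriented smooth Riemannian $4$-manifold (without boundary) with Levi-Civita connection $\nabla^g$, let $H$ be a smooth $3$-form on $M$, and let $\nabla$ be the metric connection with skew torsion $H$, i.e. $\nabla g=0$ and $g(T^\nabla(X,Y),Z)=H(X,Y,Z)$ with $T^\nabla(X,Y)=\nabla_XY-\nabla_YX-[X,Y]$ (equivalently $g(\nabla_XY,Z)=g(\nabla^g_XY,Z)+\tfrac12H(X,Y,Z)$). Write $R(X,Y)Z=\nabla_X\nabla_YZ-\nabla_Y\nabla_XZ-\nabla_{[X,Y]}Z$ for the curvature and $\mathrm{Ric}(X,Y)=\sum_i g(R(e_i,X)Y,e_i)$, with $(e_i)$ an orthonormal basis, for the Ricci tensor of a connection. Let $*$ be the Hodge star, normalised by $\alpha\wedge *\beta=\langle\alpha,\beta\rangle\,\mathrm{vol}_g$, and let $h=*H$ be the torsion $1$-form. Then, for all tangent vectors $X,Y$ at a point, $$\mathrm{Ric}^\nabla(X,Y)=\mathrm{Ric}^g(X,Y)-\tfrac12\|h\|^2g(X,Y)+\tfrac12\,h(X)h(Y)+\tfrac12\,(*dh)(X,Y),$$ and, equivalently, with the two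 arguments of $\mathrm{Ric}^\nabla$ exchanged, $$\mathrm{Ric}^\nabla(Y,X)=\mathrm{Ric}^g(X,Y)-\tfrac12\|h\|^2g(X,Y)+\tfrac12\,h(X)h(Y)-\tfrac12\,(*dh)(X,Y);$$ that is, the tensor $\mathrm{Ric}^g-\tfrac12\|h\|^2g+\tfrac12h\otimes h-\tfrac12*dh$ is the Ricci tensor of $\nabla$ in the convention $(X,Y)\mapsto\operatorname{tr}\big(Z\mapsto R(Z,Y)X\big)$. -/

import Mathlib

open Bundle Manifold Module
open scoped ContDiff Topology

noncomputable section

namespace SkewTorsion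

/-! ### Linear algebra in an oriented Euclidean space -/

theorem append_update {V : Type*} {p q : ℕ} (u : Fin p → V) (v : Fin q → V) (i : Fin q) (c : V)
    [DecidableEq (Fin q)] :
    Fin.append u (Function.update v i c) =
      Function.update (Fin.append u v) (Fin.natAdd p i) c := by
  ext1 j
  refine Fin.addCases (fun k ↦ ?_) (fun k ↦ ?_) j
  · have h : Fin.castAdd q k ≠ Fin.natAdd p i := by
      intro h
      have := congrArg Fin.val h
      simp at this
      omega
    simp [h]
  · by_cases h : k = i
    · subst h; simp
    · simp [h]

section Linear

variable {V : Type*} [NormedAddCommGroup V] [InnerProductSpace ℝ V]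

/-- The form `(v₁, …, v_q) ↦ η (u₁, …, u_p, v₁, …, v_q)`: insertion of the `p` vectors `u` into the
first `p` slots of `η`. -/
def insertVectors {p q : ℕ} (η : V [⋀^Fin (p + q)]→ₗ[ℝ] ℝ) (u : Fin p → V) :
    V [⋀^Fin q]→ₗ[ℝ] ℝ where
  toFun v := η (Fin.append u v)
  map_update_add' v i a b := by simp [append_update]
  map_update_smul' v i a b := by simp [append_update]
  map_eq_zero_of_eq' v i j h hij :=
    η.map_eq_zero_of_eq _ (i := Fin.natAdd p i) (j := Fin.natAdd p j) (by simpa using h)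
      (fun h' ↦ hij (by simpa using h'))

theorem continuous_form [FiniteDimensional ℝ V] {q : ℕ} (η : V [⋀^Fin q]→ₗ[ℝ] ℝ) :
    Continuous η := by
  classical
  let b := finBasis ℝ V
  have h : ∀ v : Fin q → V,
      η v = ∑ r : Fin q → Fin (finrank ℝ V), (∏ i, b.repr (v i) (r i)) * η (fun i ↦ b (r i)) := by
    intro v
    have h1 : η v = η.toMultilinearMap (fun i ↦ ∑ j, b.repr (v i) j • b j) := by
      simp [b.sum_repr]
    rw [h1, MultilinearMap.map_sum]
    refine Finset.sum_congr rfl fun r _ ↦ ?_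
    rw [MultilinearMap.map_smul_univ]
    rfl
  rw [funext h]
  refine continuous_finsetSum _ fun r _ ↦ (continuous_finsetProd _ fun i _ ↦ ?_).mul
    continuous_const
  exact (LinearMap.continuous_of_finiteDimensional (b.coord (r i))).comp (continuous_apply i)

/-- An alternating form on a finite-dimensional space, as a continuous alternating form. -/
def toContinuousForm [FiniteDimensional ℝ V] {q : ℕ} (η : V [⋀^Fin q]→ₗ[ℝ] ℝ) :
    V [⋀^Fin q]→L[ℝ] ℝ :=
  { η with cont := continuous_form η }

/-- The Hodge star operator on `p`-forms of an oriented Euclidean space of dimension `p + q`: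
`(*α)(v₁, …, v_q) = (1 / p!) ∑ α (e_{i₁}, …, e_{i_p}) vol (e_{i₁}, …, e_{i_p}, v₁, …, v_q)`,
the sum being over all multi-indices, for an orthonormal basis `e`. In a positive orthonormal basis
`*(e^1 ∧ ⋯ ∧ e^p) = e^{p+1} ∧ ⋯ ∧ e^{p+q}`, that is, `α ∧ *β = ⟨α, β⟩ vol`. -/
def hodgeStar {p q : ℕ} [FiniteDimensional ℝ V] [Fact (finrank ℝ V = p + q)]
    (o : Orientation ℝ V (Fin (p + q))) (α : V [⋀^Fin p]→L[ℝ] ℝ) : V [⋀^Fin q]→L[ℝ] ℝ :=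
  toContinuousForm <| ((p.factorial : ℝ)⁻¹) • ∑ s : Fin p → Fin (finrank ℝ V),
    α (fun i ↦ stdOrthonormalBasis ℝ V (s i)) •
      insertVectors o.volumeForm (fun i ↦ stdOrthonormalBasis ℝ V (s i))

/-- The squared norm `‖α‖² = ∑ α(e_i)²` of a 1-form, `e` an orthonormal basis. -/
def oneFormNormSq [FiniteDimensional ℝ V] (α : V [⋀^Fin 1]→L[ℝ] ℝ) : ℝ :=
  ∑ i, (α ![stdOrthonormalBasis ℝ V i]) ^ 2

end Linear

/-! ### Differential forms and orientations on an `n`-manifold -/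

section Forms

variable {n : ℕ} {M : Type*} [TopologicalSpace M] [ChartedSpace (EuclideanSpace ℝ (Fin n)) M]

/-- A differential `p`-form (with no regularity). -/
abbrev DiffForm (n : ℕ) (M : Type*) [TopologicalSpace M]
    [ChartedSpace (EuclideanSpace ℝ (Fin n)) M] (p : ℕ) : Type _ :=
  ∀ x : M, TangentSpace (𝓡 n) x [⋀^Fin p]→L[ℝ] ℝ

/-- A differential form is smooth if its value on (locally defined) smooth vector fields is
smooth. -/
def IsSmoothForm [IsManifold (𝓡 n) ∞ M] {p : ℕ} (η : DiffForm n M p) : Prop :=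
  ∀ (x : M) (X : Fin p → ∀ y : M, TangentSpace (𝓡 n) y),
    (∀ i, ContMDiffAt (𝓡 n) ((𝓡 n).prod 𝓘(ℝ, EuclideanSpace ℝ (Fin n))) ∞
      (fun y ↦ (X i y : TangentBundle (𝓡 n) M)) x) →
    ContMDiffAt (𝓡 n) 𝓘(ℝ, ℝ) ∞ (fun y ↦ η y (fun i ↦ X i y)) x

/-- The coordinate expression `(φ⁻¹)^* η` of a form in the preferred chart `φ` at `x`. -/
def chartForm {p : ℕ} (η : DiffForm n M p) (x : M) (z : EuclideanSpace ℝ (Fin n)) :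
    EuclideanSpace ℝ (Fin n) [⋀^Fin p]→L[ℝ] ℝ :=
  (η ((extChartAt (𝓡 n) x).symm z)).compContinuousLinearMap
    (mfderiv 𝓘(ℝ, EuclideanSpace ℝ (Fin n)) (𝓡 n) (extChartAt (𝓡 n) x).symm z)

/-- The exterior derivative of a form: at `x` it is `φ^* d (φ^{-1})^* η` for the preferred
chart `φ` at `x`. -/
def extDerivForm {p : ℕ} (η : DiffForm n M p) : DiffForm n M (p + 1) := fun x ↦
  (extDeriv (chartForm η x) (extChartAt (𝓡 n) x x)).compContinuousLinearMap
    (mfderiv (𝓡 n) 𝓘(ℝ, EuclideanSpace ℝ (Fin n)) (extChartAt (𝓡 n) x) x)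

/-- A family of orientations of the tangent spaces is an orientation of the manifold if, near each
point, it is the orientation given by a smooth local frame. -/
def IsManifoldOrientation [IsManifold (𝓡 n) ∞ M]
    (o : ∀ x : M, Orientation ℝ (TangentSpace (𝓡 n) x) (Fin n)) : Prop :=
  ∀ x : M, ∃ X : Fin n → ∀ y : M, TangentSpace (𝓡 n) y,
    (∀ i, ContMDiffAt (𝓡 n) ((𝓡 n).prod 𝓘(ℝ, EuclideanSpace ℝ (Fin n))) ∞
      (fun y ↦ (X i y : TangentBundle (𝓡 n) M)) x) ∧
    ∀ᶠ y in 𝓝 x, ∃ b : Basis (Fin n) ℝ (TangentSpace (𝓡 n) y),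
      (∀ i, b i = X i y) ∧ b.orientation = o y

instance finiteDimensional_tangentSpace (x : M) :
    FiniteDimensional ℝ (TangentSpace (𝓡 n) x) :=
  inferInstanceAs (FiniteDimensional ℝ (EuclideanSpace ℝ (Fin n)))

instance finrank_tangentSpace (x : M) : Fact (finrank ℝ (TangentSpace (𝓡 n) x) = n) :=
  ⟨finrank_euclideanSpace_fin (𝕜 := ℝ) (n := n)⟩

end Forms

/-! ### Connections on the tangent bundle of a Riemannian manifold -/

section Connections

variable {n : ℕ} {M : Type*} [TopologicalSpace M] [ChartedSpace (EuclideanSpace ℝ (Fin n)) M]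
  [IsManifold (𝓡 n) ∞ M]

/-- Connections (covariant derivatives) on the tangent bundle; `∇_X Y` is `x ↦ nabla Y x (X x)`. -/
abbrev TangentConnection (n : ℕ) (M : Type*) [TopologicalSpace M]
    [ChartedSpace (EuclideanSpace ℝ (Fin n)) M] [IsManifold (𝓡 n) ∞ M] : Type _ :=
  CovariantDerivative (𝓡 n) (EuclideanSpace ℝ (Fin n)) (TangentSpace (𝓡 n) : M → Type _)

/-- `R(X, Y) Z = ∇_X ∇_Y Z - ∇_Y ∇_X Z - ∇_{[X, Y]} Z` for vector fields. -/
def curvatureField (nabla : TangentConnection n M) (X Y Z : ∀ x : M, TangentSpace (𝓡 n) x) (x : M) :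
    TangentSpace (𝓡 n) x :=
  nabla (fun y ↦ nabla Z y (Y y)) x (X x) - nabla (fun y ↦ nabla Z y (X y)) x (Y x)
    - nabla Z x (VectorField.mlieBracket (𝓡 n) X Y x)

/-- The curvature tensor `R(u, v) w` at a point, computed with vector fields that extend
`u, v, w` and are smooth near the point. -/
def curvature (nabla : TangentConnection n M) (x : M) (u v w : TangentSpace (𝓡 n) x) :
    TangentSpace (𝓡 n) x :=
  curvatureField nabla (FiberBundle.extend (EuclideanSpace ℝ (Fin n)) u)
    (FiberBundle.extend (EuclideanSpace ℝ (Fin n)) v)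
    (FiberBundle.extend (EuclideanSpace ℝ (Fin n)) w) x

variable [RiemannianBundle (fun x : M ↦ TangentSpace (𝓡 n) x)]

/-- The Ricci tensor `Ric(u, v) = ∑ g(R(e_i, u) v, e_i)`, the trace of `w ↦ R(w, u) v`. -/
def ricci (nabla : TangentConnection n M) (x : M) (u v : TangentSpace (𝓡 n) x) : ℝ :=
  ∑ i, inner ℝ (curvature nabla x (stdOrthonormalBasis ℝ (TangentSpace (𝓡 n) x) i) u v)
    (stdOrthonormalBasis ℝ (TangentSpace (𝓡 n) x) i)

variable [IsContMDiffRiemannianBundle (𝓡 n) ∞ (EuclideanSpace ℝ (Fin n))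
  (fun x : M ↦ TangentSpace (𝓡 n) x)]

instance isContMDiffRiemannianBundle_one :
    IsContMDiffRiemannianBundle (𝓡 n) 1 (EuclideanSpace ℝ (Fin n))
      (fun x : M ↦ TangentSpace (𝓡 n) x) :=
  IsContMDiffRiemannianBundle.of_le (n := ∞) (by exact_mod_cast le_top)

/-- The Levi-Civita connection: metric and torsion-free. -/
def IsLeviCivita (nabla : TangentConnection n M) : Prop :=
  nabla.IsMetricCompatible ∧ nabla.torsion = 0

/-- `nabla` is the metric connection with skew torsion `H`: it is metric, and `g(T(X, Y), Z)` is
the 3-form `H(X, Y, Z)`. -/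
def HasSkewTorsion (nabla : TangentConnection n M) (H : DiffForm n M 3) : Prop :=
  nabla.IsMetricCompatible ∧
    ∀ (x : M) (u v w : TangentSpace (𝓡 n) x), inner ℝ (nabla.torsion x u v) w = H x ![u, v, w]

end Connections

/-! ### Dimension four -/

section Four

variable {M : Type*} [TopologicalSpace M] [ChartedSpace (EuclideanSpace ℝ (Fin 4)) M]
  [RiemannianBundle (fun x : M ↦ TangentSpace (𝓡 4) x)]

/-- The torsion 1-form `h = *H` of a 3-form on an oriented Riemannian 4-manifold. -/
def torsionOneForm (o : ∀ x : M, Orientation ℝ (TangentSpace (𝓡 4) x) (Fin 4))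
    (H : DiffForm 4 M 3) : DiffForm 4 M 1 := fun x ↦
  hodgeStar (p := 3) (q := 1) (o x) (H x)

/-- The Hodge star on 2-forms of an oriented Riemannian 4-manifold. -/
def starTwoForm (o : ∀ x : M, Orientation ℝ (TangentSpace (𝓡 4) x) (Fin 4))
    (η : DiffForm 4 M 2) : DiffForm 4 M 2 := fun x ↦
  hodgeStar (p := 2) (q := 2) (o x) (η x)

end Four

end SkewTorsion

end

/-! Write ∇ = ∇^g + A. Two metric connections differ by a tensor with ⟨A_u v, w⟩ skew in v, w; since
∇^g is torsion-free, its antisymmetrisation in u, v is H, which forces ⟨A_u v, w⟩ = ½ H(u, v, w)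
(`inner_contorsion`). Expanding the curvature and tracing gives, in every dimension (`ricci_eq`),
Ric^∇(u, v) = Ric^g(u, v) + ½ ∑ (∇^g_{e_i} H)(u, v, e_i) − ¼ ∑ H(u, e_i, e_j) H(v, e_i, e_j). In
dimension four H = −ι_B vol with B the vector dual to h = *H. Contracting two volume forms turns the
quadratic term into −½‖h‖²g + ½ h ⊗ h (`sum_threeForm_mul_threeForm`). As vol is parallel
(`mvfderiv_volumeForm`), the derivative term is −½ ∑ vol(∇_{e_i} B, u, v, e_i), which is ½ *dh
because dh is the antisymmetrisation of ∇B (`hodgeStar_antisymmetrization`). Exchanging the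
arguments changes only the sign of *dh, by the symmetry of Ric^g (`IsLeviCivita.ricci_symm`).
Everything is computed with coordinate fields, which commute. The connections are not assumed to
preserve smoothness: differentiability of each field to be differentiated again is derived from its
inner products with a frame. -/

noncomputable section

namespace SkewTorsion

/-! ### Hodge star and volume form of a four-dimensional Euclidean space, in coordinates. -/

section Linear

variable {V : Type*} [NormedAddCommGroup V] [InnerProductSpace ℝ V]

/-- The determinant of the `4 × 4` matrix with rows `a, b, c, d`. -/
def det4 (a b c d : Fin 4 → ℝ) : ℝ :=
  (a 0 * b 1 - a 1 * b 0) * (c 2 * d 3 - c 3 * d 2)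
    - (a 0 * b 2 - a 2 * b 0) * (c 1 * d 3 - c 3 * d 1)
    + (a 0 * b 3 - a 3 * b 0) * (c 1 * d 2 - c 2 * d 1)
    + (a 1 * b 2 - a 2 * b 1) * (c 0 * d 3 - c 3 * d 0)
    - (a 1 * b 3 - a 3 * b 1) * (c 0 * d 2 - c 2 * d 0)
    + (a 2 * b 3 - a 3 * b 2) * (c 0 * d 1 - c 1 * d 0)

/-- `det4` is the Laplace expansion along the first two rows, an explicit polynomial on which `ring`
and `linear_combination` can work. -/
theorem det_eq_det4 (A : Matrix (Fin 4) (Fin 4) ℝ) : A.det = det4 (A 0) (A 1) (A 2) (A 3) := by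
  simp [Matrix.det_succ_row_zero, Fin.sum_univ_succ, det4, Fin.succAbove]
  ring

theorem alternatingMap_sum_apply {ι : Type*} {q : ℕ} (s : Finset ι) (f : ι → V [⋀^Fin q]→ₗ[ℝ] ℝ)
    (v : Fin q → V) : (∑ i ∈ s, f i) v = ∑ i ∈ s, f i v := by
  classical
  induction s using Finset.induction_on with
  | empty => simp
  | insert a s ha ih => simp [Finset.sum_insert ha, ih]

theorem hodgeStar_apply {p q : ℕ} [FiniteDimensional ℝ V] [Fact (finrank ℝ V = p + q)]
    (o : Orientation ℝ V (Fin (p + q))) (α : V [⋀^Fin p]→L[ℝ] ℝ) (v : Fin q → V) :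
    hodgeStar o α v = (p.factorial : ℝ)⁻¹ * ∑ s : Fin p → Fin (finrank ℝ V),
      α (fun i ↦ stdOrthonormalBasis ℝ V (s i)) *
        o.volumeForm (Fin.append (fun i ↦ stdOrthonormalBasis ℝ V (s i)) v) := by
  change ((p.factorial : ℝ)⁻¹ • ∑ s : Fin p → Fin (finrank ℝ V),
    α (fun i ↦ stdOrthonormalBasis ℝ V (s i)) • insertVectors o.volumeForm
      (fun i ↦ stdOrthonormalBasis ℝ V (s i))) v = _
  simp only [AlternatingMap.smul_apply, alternatingMap_sum_apply, smul_eq_mul]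
  rfl

variable [Fact (finrank ℝ V = 4)] [FiniteDimensional ℝ V]

variable (V) in
/-- The standard orthonormal basis of a `4`-dimensional space, indexed by `Fin 4`. -/
def onb4 : OrthonormalBasis (Fin 4) ℝ V :=
  (stdOrthonormalBasis ℝ V).reindex (finCongr Fact.out)

theorem inner_onb4 (v : V) (i : Fin 4) : inner ℝ v (onb4 V i) = (onb4 V).repr v i := by
  rw [real_inner_comm, OrthonormalBasis.repr_apply_apply]

theorem inner_eq_sum_onb4_repr (v w : V) :
    inner ℝ v w = ∑ i, (onb4 V).repr v i * (onb4 V).repr w i := by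
  simp_rw [← (onb4 V).sum_inner_mul_inner v w, inner_onb4, OrthonormalBasis.repr_apply_apply]

theorem sum_stdOrthonormalBasis {α : Type*} [AddCommMonoid α] (f : V → α) :
    ∑ i, f (stdOrthonormalBasis ℝ V i) = ∑ i, f (onb4 V i) :=
  Fintype.sum_equiv (finCongr Fact.out) _ _ fun i ↦ by simp [onb4]

theorem sum_pi_stdOrthonormalBasis {α : Type*} [AddCommMonoid α] {p : ℕ}
    (f : (Fin p → V) → α) :
    ∑ s : Fin p → Fin (finrank ℝ V), f (fun i ↦ stdOrthonormalBasis ℝ V (s i)) =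
      ∑ s : Fin p → Fin 4, f (fun i ↦ onb4 V (s i)) :=
  Fintype.sum_equiv (Equiv.arrowCongr (Equiv.refl _) (finCongr Fact.out)) _ _ fun i ↦ by
    simp [onb4]

/-- σ compares `o` with the orientation of `onb4`. The identities below are quadratic in the volume
form or linear in it on both sides, so σ² = 1 is all that matters. -/
theorem exists_volumeForm_eq_det4 (o : Orientation ℝ V (Fin 4)) :
    ∃ σ : ℝ, σ * σ = 1 ∧ ∀ v : Fin 4 → V, o.volumeForm v =
      σ * det4 ((onb4 V).repr (v 0)) ((onb4 V).repr (v 1)) ((onb4 V).repr (v 2))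
        ((onb4 V).repr (v 3)) := by
  have hdet : ∀ v : Fin 4 → V, (onb4 V).toBasis.det v =
      det4 ((onb4 V).repr (v 0)) ((onb4 V).repr (v 1)) ((onb4 V).repr (v 2))
        ((onb4 V).repr (v 3)) := by
    intro v
    rw [Basis.det_apply, ← Matrix.det_transpose, det_eq_det4]
    rfl
  by_cases h : (onb4 V).toBasis.orientation = o
  · exact ⟨1, by norm_num, fun v ↦ by rw [o.volumeForm_robust _ h, hdet, one_mul]⟩
  · refine ⟨-1, by norm_num, fun v ↦ ?_⟩
    rw [o.volumeForm_robust_neg _ h, AlternatingMap.neg_apply, hdet, neg_one_mul]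


theorem sum_fin_three_pi (f : (Fin 3 → Fin 4) → ℝ) :
    ∑ s, f s = ∑ i, ∑ j, ∑ k, f ![i, j, k] := by
  rw [← (Fin.consEquiv fun _ ↦ Fin 4).sum_comp, Fintype.sum_prod_type]
  refine Finset.sum_congr rfl fun i _ ↦ ?_
  rw [← (finTwoArrowEquiv (Fin 4)).symm.sum_comp, Fintype.sum_prod_type]
  rfl

theorem sum_fin_two_pi (f : (Fin 2 → Fin 4) → ℝ) :
    ∑ s, f s = ∑ i, ∑ j, f ![i, j] := by
  rw [← (finTwoArrowEquiv (Fin 4)).symm.sum_comp, Fintype.sum_prod_type]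
  rfl

theorem hodgeStar_threeForm_apply (o : Orientation ℝ V (Fin 4)) (α : V [⋀^Fin 3]→L[ℝ] ℝ) (w : V) :
    hodgeStar (p := 3) (q := 1) o α ![w] = 6⁻¹ * ∑ i, ∑ j, ∑ k,
      α ![onb4 V i, onb4 V j, onb4 V k] *
        o.volumeForm ![onb4 V i, onb4 V j, onb4 V k, w] := by
  have h : hodgeStar (p := 3) (q := 1) o α ![w] = ((3 : ℕ).factorial : ℝ)⁻¹ *
      ∑ s : Fin 3 → Fin (finrank ℝ V), α (fun i ↦ stdOrthonormalBasis ℝ V (s i)) *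
        o.volumeForm (Fin.append (fun i ↦ stdOrthonormalBasis ℝ V (s i)) ![w]) := by
    exact hodgeStar_apply (p := 3) (q := 1) o α ![w]
  rw [h, sum_pi_stdOrthonormalBasis
    (fun t : Fin 3 → V ↦ α t * o.volumeForm (Fin.append t ![w])), sum_fin_three_pi]
  have hf : ((3 : ℕ).factorial : ℝ) = 6 := by norm_num [Nat.factorial]
  rw [hf]
  congr 1
  refine Finset.sum_congr rfl fun i _ ↦ Finset.sum_congr rfl fun j _ ↦
    Finset.sum_congr rfl fun k _ ↦ ?_
  congr 2 <;> · ext a; fin_cases a <;> rfl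

theorem hodgeStar_twoForm_apply (o : Orientation ℝ V (Fin 4)) (α : V [⋀^Fin 2]→L[ℝ] ℝ) (w z : V) :
    hodgeStar (p := 2) (q := 2) o α ![w, z] = 2⁻¹ * ∑ i, ∑ j,
      α ![onb4 V i, onb4 V j] * o.volumeForm ![onb4 V i, onb4 V j, w, z] := by
  have h : hodgeStar (p := 2) (q := 2) o α ![w, z] = ((2 : ℕ).factorial : ℝ)⁻¹ *
      ∑ s : Fin 2 → Fin (finrank ℝ V), α (fun i ↦ stdOrthonormalBasis ℝ V (s i)) *
        o.volumeForm (Fin.append (fun i ↦ stdOrthonormalBasis ℝ V (s i)) ![w, z]) := by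
    exact hodgeStar_apply (p := 2) (q := 2) o α ![w, z]
  rw [h, sum_pi_stdOrthonormalBasis
    (fun t : Fin 2 → V ↦ α t * o.volumeForm (Fin.append t ![w, z])), sum_fin_two_pi]
  have hf : ((2 : ℕ).factorial : ℝ) = 2 := by norm_num [Nat.factorial]
  rw [hf]
  congr 1
  refine Finset.sum_congr rfl fun i _ ↦ Finset.sum_congr rfl fun j _ ↦ ?_
  congr 2 <;> · ext a; fin_cases a <;> rfl

/-- Every `3`-form in dimension four is the contraction of the volume form with a vector. -/
theorem exists_eq_neg_volumeForm (o : Orientation ℝ V (Fin 4)) (α : V [⋀^Fin 3]→L[ℝ] ℝ) :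
    ∃ b : V, ∀ u v w : V, α ![u, v, w] = -o.volumeForm ![b, u, v, w] := by
  obtain ⟨σ, hσ, hvol⟩ := exists_volumeForm_eq_det4 o
  set e := onb4 V with he
  set T : Fin 4 → Fin 4 → Fin 4 → ℝ := fun i j k ↦ α ![e i, e j, e k] with hT
  have h1 : ∀ i j k, T i j k = -T j i k := by
    intro i j k
    have := α.toAlternatingMap.map_swap ![e i, e j, e k] (i := 0) (j := 1) (by decide)
    rw [show (![e i, e j, e k] ∘ (Equiv.swap 0 1 : Equiv.Perm (Fin 3))) = ![e j, e i, e k] by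
      ext a; fin_cases a <;> rfl] at this
    simp only [hT]
    have h2 : α ![e j, e i, e k] = - α ![e i, e j, e k] := this
    rw [h2, neg_neg]
  have h2 : ∀ i j k, T i j k = -T i k j := by
    intro i j k
    have := α.toAlternatingMap.map_swap ![e i, e j, e k] (i := 1) (j := 2) (by decide)
    rw [show (![e i, e j, e k] ∘ (Equiv.swap 1 2 : Equiv.Perm (Fin 3))) = ![e i, e k, e j] by
      ext a; fin_cases a <;> rfl] at this
    simp only [hT]
    have h2 : α ![e i, e k, e j] = - α ![e i, e j, e k] := this
    rw [h2, neg_neg]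
  -- Solves α(e_j, e_k, e_l) = −σ det(b, e_j, e_k, e_l) on increasing triples; the signs alternate
  -- with the position of the missing index.
  let c : Fin 4 → ℝ := ![-σ * T 1 2 3, σ * T 0 2 3, -σ * T 0 1 3, σ * T 0 1 2]
  let b : V := ∑ i, c i • e i
  have hb : ∀ i, e.repr b i = c i := by
    intro i
    simp [b, Pi.single_apply]
  have hσ' : ∀ t, σ * (σ * t) = t := fun t ↦ by rw [← mul_assoc, hσ, one_mul]
  have key : α.toAlternatingMap = -(o.volumeForm.curryLeft b) := by
    refine Basis.ext_alternating e.toBasis fun s _ ↦ ?_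
    have hs : (fun i ↦ e.toBasis (s i)) = ![e (s 0), e (s 1), e (s 2)] := by
      ext a; fin_cases a <;> simp
    rw [hs]
    change T (s 0) (s 1) (s 2) = - o.volumeForm ![b, e (s 0), e (s 1), e (s 2)]
    rw [hvol]
    generalize s 0 = i
    generalize s 1 = j
    generalize s 2 = k
    -- These six transpositions run once around the cycle of all orderings of (i, j, k). They reduce
    -- every triple to an increasing one, and force T = 0 when an index repeats.
    have h3 := h1 i j k
    have h4 := h2 i j k
    have h5 := h2 j i k
    have h6 := h1 j k i
    have h7 := h2 k j i
    have h8 := h1 k i j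
    clear_value T
    clear h1 h2 hvol hs
    fin_cases i <;> fin_cases j <;> fin_cases k <;>
      simp [det4, hb, c, hσ'] at h3 h4 h5 h6 h7 h8 ⊢ <;> linarith
  refine ⟨b, fun u v w ↦ ?_⟩
  have := DFunLike.congr_fun key ![u, v, w]
  exact this

/-- Moving w past three slots costs a sign, which cancels the minus in the hypothesis; the six
orderings of each triple cancel 1/3!. -/
theorem hodgeStar_neg_volumeForm (o : Orientation ℝ V (Fin 4)) {α : V [⋀^Fin 3]→L[ℝ] ℝ} {b : V}
    (h : ∀ u v w : V, α ![u, v, w] = -o.volumeForm ![b, u, v, w]) (w : V) :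
    hodgeStar (p := 3) (q := 1) o α ![w] = inner ℝ b w := by
  obtain ⟨σ, hσ, hvol⟩ := exists_volumeForm_eq_det4 o
  rw [hodgeStar_threeForm_apply]
  simp only [h, hvol, inner_eq_sum_onb4_repr]
  simp [Fin.sum_univ_four, det4]
  generalize (onb4 V).repr b = B
  generalize (onb4 V).repr w = W
  linear_combination (B 0 * W 0 + B 1 * W 1 + B 2 * W 2 + B 3 * W 3) * hσ

omit [Fact (finrank ℝ V = 4)] in
theorem oneFormNormSq_eq {α : V [⋀^Fin 1]→L[ℝ] ℝ} {b : V} (h : ∀ w, α ![w] = inner ℝ b w) :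
    oneFormNormSq α = inner ℝ b b := by
  simp_rw [oneFormNormSq, h]
  rw [← (stdOrthonormalBasis ℝ V).sum_inner_mul_inner]
  exact Finset.sum_congr rfl fun i _ ↦ by rw [sq, real_inner_comm b]

/-- Contracting two volume forms over two common slots gives 2! times the 2 × 2 determinant of the
inner products of (b, u) with (b, v). -/
theorem sum_threeForm_mul_threeForm (o : Orientation ℝ V (Fin 4)) {α : V [⋀^Fin 3]→L[ℝ] ℝ} {b : V}
    (h : ∀ u v w : V, α ![u, v, w] = -o.volumeForm ![b, u, v, w]) (u v : V) :
    ∑ i, ∑ j, α ![u, stdOrthonormalBasis ℝ V i, stdOrthonormalBasis ℝ V j] *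
        α ![v, stdOrthonormalBasis ℝ V i, stdOrthonormalBasis ℝ V j] =
      2 * (inner ℝ b b * inner ℝ u v - inner ℝ b u * inner ℝ b v) := by
  obtain ⟨σ, hσ, hvol⟩ := exists_volumeForm_eq_det4 o
  rw [sum_stdOrthonormalBasis fun x ↦ ∑ j, α ![u, x, stdOrthonormalBasis ℝ V j] *
    α ![v, x, stdOrthonormalBasis ℝ V j]]
  simp_rw [fun x ↦ sum_stdOrthonormalBasis fun y ↦ α ![u, x, y] * α ![v, x, y]]
  simp only [h, hvol, inner_eq_sum_onb4_repr]
  simp [Fin.sum_univ_four, det4]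
  generalize (onb4 V).repr b = B
  generalize (onb4 V).repr u = U
  generalize (onb4 V).repr v = W
  linear_combination (2 * ((B 0 * B 0 + B 1 * B 1 + B 2 * B 2 + B 3 * B 3) *
    (U 0 * W 0 + U 1 * W 1 + U 2 * W 2 + U 3 * W 3) -
    (B 0 * U 0 + B 1 * U 1 + B 2 * U 2 + B 3 * U 3) *
    (B 0 * W 0 + B 1 * W 1 + B 2 * W 2 + B 3 * W 3))) * hσ

/-- The two halves of η contribute equally, absorbing the factor ½ and leaving ∑ vol(e_i, D e_i, u,
v); reordering the slots is an odd permutation. -/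
theorem hodgeStar_antisymmetrization (o : Orientation ℝ V (Fin 4)) {η : V [⋀^Fin 2]→L[ℝ] ℝ}
    (D : V → V) (h : ∀ u v, η ![u, v] = inner ℝ (D u) v - inner ℝ (D v) u) (u v : V) :
    hodgeStar (p := 2) (q := 2) o η ![u, v] =
      -∑ i, o.volumeForm ![D (stdOrthonormalBasis ℝ V i), u, v, stdOrthonormalBasis ℝ V i] := by
  obtain ⟨σ, hσ, hvol⟩ := exists_volumeForm_eq_det4 o
  rw [hodgeStar_twoForm_apply, sum_stdOrthonormalBasis fun x ↦ o.volumeForm ![D x, u, v, x]]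
  simp only [h, hvol, inner_onb4]
  simp [Fin.sum_univ_four, det4]
  ring

end Linear

/-! ### Coordinate vector fields and derivatives along them. -/

section CoordinateFields

variable {n : ℕ} {M : Type*} [TopologicalSpace M] [ChartedSpace (EuclideanSpace ℝ (Fin n)) M]
  [IsManifold (𝓡 n) ∞ M]

/-- The vector field with constant components in the preferred chart at `x` and value `u` at `x`. -/
abbrev coordField {x : M} (u : TangentSpace (𝓡 n) x) (y : M) : TangentSpace (𝓡 n) y :=
  FiberBundle.extend (EuclideanSpace ℝ (Fin n)) u y

/-- The components of a tangent vector at `x` in the preferred chart at `x`. -/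
abbrev coordVec {x : M} (u : TangentSpace (𝓡 n) x) : EuclideanSpace ℝ (Fin n) :=
  (trivializationAt (EuclideanSpace ℝ (Fin n)) (TangentSpace (𝓡 n)) x ⟨x, u⟩).2

theorem contMDiffAt_extChartAt_symm {x : M} {z : EuclideanSpace ℝ (Fin n)}
    (hz : z ∈ (extChartAt (𝓡 n) x).target) :
    ContMDiffAt 𝓘(ℝ, EuclideanSpace ℝ (Fin n)) (𝓡 n) ∞ (extChartAt (𝓡 n) x).symm z :=
  (contMDiffOn_extChartAt_symm x z hz).contMDiffAt ((isOpen_extChartAt_target x).mem_nhds hz)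

theorem mdifferentiableAt_extChartAt_symm {x : M} {z : EuclideanSpace ℝ (Fin n)}
    (hz : z ∈ (extChartAt (𝓡 n) x).target) :
    MDifferentiableAt 𝓘(ℝ, EuclideanSpace ℝ (Fin n)) (𝓡 n) (extChartAt (𝓡 n) x).symm z :=
  (contMDiffAt_extChartAt_symm hz).mdifferentiableAt (by simp)

/-- The tangent bundle is trivialised at x by the derivative of the chart, so the extension of u is
the push-forward of a constant field under the inverse chart. -/
theorem coordField_eq_mfderiv {x : M} (u : TangentSpace (𝓡 n) x) {y : M}
    (hy : y ∈ (extChartAt (𝓡 n) x).source) :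
    coordField u y = mfderiv 𝓘(ℝ, EuclideanSpace ℝ (Fin n)) (𝓡 n) (extChartAt (𝓡 n) x).symm
      (extChartAt (𝓡 n) x y) (coordVec u) := by
  have hy' : y ∈ (chartAt (EuclideanSpace ℝ (Fin n)) x).source := by simpa using hy
  have h := TangentBundle.symmL_trivializationAt (I := 𝓡 n) hy'
  rw [(𝓡 n).range_eq_univ, mfderivWithin_univ] at h
  refine Eq.trans ?_ (DFunLike.congr_fun h (coordVec u))
  rw [coordField, FiberBundle.extend, Trivialization.symmL_apply]
  exact hy'

theorem mfderiv_extChartAt_eq_coordVec {x : M} (u : TangentSpace (𝓡 n) x) :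
    mfderiv (𝓡 n) 𝓘(ℝ, EuclideanSpace ℝ (Fin n)) (extChartAt (𝓡 n) x) x u = coordVec u := by
  have h := TangentBundle.continuousLinearMapAt_trivializationAt (I := 𝓡 n)
    (mem_chart_source (EuclideanSpace ℝ (Fin n)) x)
  refine (DFunLike.congr_fun h u).symm.trans ?_
  rw [Trivialization.continuousLinearMapAt_apply, Trivialization.coe_linearMapAt_of_mem]
  exact FiberBundle.mem_baseSet_trivializationAt' x

theorem contMDiffAt_coordField {x : M} (u : TangentSpace (𝓡 n) x) :
    ContMDiffAt (𝓡 n) ((𝓡 n).prod 𝓘(ℝ, EuclideanSpace ℝ (Fin n))) ∞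
      (fun y ↦ (coordField u y : TangentBundle (𝓡 n) M)) x :=
  FiberBundle.contMDiffAt_extend (𝓡 n) _ u

theorem mdifferentiableAt_comp_extChartAt_symm {x y : M} {f : M → ℝ}
    (hy : y ∈ (extChartAt (𝓡 n) x).source) (hf : MDifferentiableAt (𝓡 n) 𝓘(ℝ, ℝ) f y) :
    DifferentiableAt ℝ (f ∘ (extChartAt (𝓡 n) x).symm) (extChartAt (𝓡 n) x y) := by
  rw [← mdifferentiableAt_iff_differentiableAt]
  refine MDifferentiableAt.comp (I' := 𝓡 n) _ ?_
    (mdifferentiableAt_extChartAt_symm ((extChartAt (𝓡 n) x).map_source hy))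
  rwa [(extChartAt (𝓡 n) x).left_inv hy]

theorem contDiffAt_comp_extChartAt_symm {x y : M} {f : M → ℝ} {k : ℕ∞}
    (hy : y ∈ (extChartAt (𝓡 n) x).source) (hf : ContMDiffAt (𝓡 n) 𝓘(ℝ, ℝ) k f y) :
    ContDiffAt ℝ k (f ∘ (extChartAt (𝓡 n) x).symm) (extChartAt (𝓡 n) x y) := by
  rw [← contMDiffAt_iff_contDiffAt]
  refine ContMDiffAt.comp (I' := 𝓡 n) _ ?_
    ((contMDiffAt_extChartAt_symm ((extChartAt (𝓡 n) x).map_source hy)).of_le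
      (by exact_mod_cast le_top))
  rwa [(extChartAt (𝓡 n) x).left_inv hy]

theorem mdifferentiableAt_of_comp_extChartAt_symm {x : M} {f : M → ℝ}
    (hf : DifferentiableAt ℝ (f ∘ (extChartAt (𝓡 n) x).symm) (extChartAt (𝓡 n) x x)) :
    MDifferentiableAt (𝓡 n) 𝓘(ℝ, ℝ) f x := by
  have h := MDifferentiableAt.comp x hf.mdifferentiableAt
    (mdifferentiableAt_extChartAt (I := 𝓡 n) (mem_chart_source _ x))
  refine h.congr_of_eventuallyEq ?_
  filter_upwards [extChartAt_source_mem_nhds (I := 𝓡 n) x] with y hy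
  simp only [Function.comp_apply, (extChartAt (𝓡 n) x).left_inv hy]

theorem mvfderiv_coordField {x y : M} {f : M → ℝ} (hy : y ∈ (extChartAt (𝓡 n) x).source)
    (hf : MDifferentiableAt (𝓡 n) 𝓘(ℝ, ℝ) f y) (u : TangentSpace (𝓡 n) x) :
    mvfderiv (𝓡 n) f y (coordField u y) =
      fderiv ℝ (f ∘ (extChartAt (𝓡 n) x).symm) (extChartAt (𝓡 n) x y) (coordVec u) := by
  rw [coordField_eq_mfderiv u hy]
  have hl := (extChartAt (𝓡 n) x).left_inv hy
  have h := mvfderiv_comp_apply_of_eq (I := 𝓘(ℝ, EuclideanSpace ℝ (Fin n))) (I' := 𝓡 n)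
    (extChartAt (𝓡 n) x y) (g := f)
    hf (mdifferentiableAt_extChartAt_symm ((extChartAt (𝓡 n) x).map_source hy)) hl (coordVec u)
  exact h.symm.trans (DFunLike.congr_fun mfderiv_eq_fderiv _)

theorem mvfderiv_eq_fderiv {x : M} {f : M → ℝ}
    (hf : MDifferentiableAt (𝓡 n) 𝓘(ℝ, ℝ) f x) (u : TangentSpace (𝓡 n) x) :
    mvfderiv (𝓡 n) f x u =
      fderiv ℝ (f ∘ (extChartAt (𝓡 n) x).symm) (extChartAt (𝓡 n) x x) (coordVec u) := by
  rw [← mvfderiv_coordField (mem_extChartAt_source x) hf]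
  simp

theorem eventually_mvfderiv_coordField_comp {x : M} {f : M → ℝ}
    (hf : ∀ᶠ y in 𝓝 x, MDifferentiableAt (𝓡 n) 𝓘(ℝ, ℝ) f y) (u : TangentSpace (𝓡 n) x) :
    (fun y ↦ mvfderiv (𝓡 n) f y (coordField u y)) ∘ (extChartAt (𝓡 n) x).symm
      =ᶠ[𝓝 (extChartAt (𝓡 n) x x)]
    fun z ↦ fderiv ℝ (f ∘ (extChartAt (𝓡 n) x).symm) z (coordVec u) := by
  have hc := (continuousAt_extChartAt_symm (I := 𝓡 n) x).eventually
    (p := fun y ↦ MDifferentiableAt (𝓡 n) 𝓘(ℝ, ℝ) f y)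
    (by rwa [(extChartAt (𝓡 n) x).left_inv (mem_extChartAt_source x)])
  filter_upwards [hc, extChartAt_target_mem_nhds (I := 𝓡 n) x] with z hz hz'
  have h := mvfderiv_coordField ((extChartAt (𝓡 n) x).map_target hz') hz u
  rw [(extChartAt (𝓡 n) x).right_inv hz'] at h
  exact h

theorem ContMDiffAt.eventually_mdifferentiableAt {x : M} {f : M → ℝ}
    (hf : ContMDiffAt (𝓡 n) 𝓘(ℝ, ℝ) 2 f x) :
    ∀ᶠ y in 𝓝 x, MDifferentiableAt (𝓡 n) 𝓘(ℝ, ℝ) f y :=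
  ((contMDiffAt_iff_contMDiffAt_nhds (by simp)).1 hf).mono fun _ h ↦ h.mdifferentiableAt (by simp)

theorem mdifferentiableAt_mvfderiv_coordField {x : M} {f : M → ℝ}
    (hf : ContMDiffAt (𝓡 n) 𝓘(ℝ, ℝ) 2 f x) (u : TangentSpace (𝓡 n) x) :
    MDifferentiableAt (𝓡 n) 𝓘(ℝ, ℝ) (fun y ↦ mvfderiv (𝓡 n) f y (coordField u y)) x := by
  apply mdifferentiableAt_of_comp_extChartAt_symm
  refine DifferentiableAt.congr_of_eventuallyEq ?_
    (eventually_mvfderiv_coordField_comp (ContMDiffAt.eventually_mdifferentiableAt hf) u)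
  have h := (contDiffAt_comp_extChartAt_symm (k := 2) (mem_extChartAt_source x) hf).fderiv_right
    (m := 1) (by norm_num)
  exact (h.differentiableAt (by simp)).clm_apply (differentiableAt_const _)

/-- Coordinate vector fields commute as derivations. -/
theorem mvfderiv_mvfderiv_coordField_comm {x : M} {f : M → ℝ}
    (hf : ContMDiffAt (𝓡 n) 𝓘(ℝ, ℝ) 2 f x) (u v : TangentSpace (𝓡 n) x) :
    mvfderiv (𝓡 n) (fun y ↦ mvfderiv (𝓡 n) f y (coordField u y)) x v =
      mvfderiv (𝓡 n) (fun y ↦ mvfderiv (𝓡 n) f y (coordField v y)) x u := by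
  have hc := contDiffAt_comp_extChartAt_symm (k := 2) (mem_extChartAt_source x) hf
  have hd : DifferentiableAt ℝ (fderiv ℝ (f ∘ (extChartAt (𝓡 n) x).symm))
      (extChartAt (𝓡 n) x x) :=
    (hc.fderiv_right (m := 1) (by norm_num)).differentiableAt (by simp)
  have key : ∀ u v : TangentSpace (𝓡 n) x,
      mvfderiv (𝓡 n) (fun y ↦ mvfderiv (𝓡 n) f y (coordField u y)) x v =
        fderiv ℝ (fderiv ℝ (f ∘ (extChartAt (𝓡 n) x).symm)) (extChartAt (𝓡 n) x x)
          (coordVec v) (coordVec u) := by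
    intro u v
    rw [mvfderiv_eq_fderiv (mdifferentiableAt_mvfderiv_coordField hf u),
      (eventually_mvfderiv_coordField_comp
        (ContMDiffAt.eventually_mdifferentiableAt hf) u).fderiv_eq,
      fderiv_clm_apply hd (differentiableAt_const _)]
    simp
  rw [key, key]
  exact hc.isSymmSndFDerivAt (by simp) _ _

theorem mlieBracket_const {E : Type*} [NormedAddCommGroup E] [NormedSpace ℝ E] (a b z : E) :
    VectorField.mlieBracket 𝓘(ℝ, E) (fun _ ↦ a) (fun _ ↦ b) z = (0 : E) := by
  have h := congrFun (VectorField.mlieBracketWithin_eq_lieBracketWithin (𝕜 := ℝ) (E := E)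
    (V := fun _ ↦ a) (W := fun _ ↦ b) (s := Set.univ)) z
  have h' := congrFun (VectorField.mlieBracketWithin_univ (I := 𝓘(ℝ, E)) (V := fun _ ↦ a)
    (W := fun _ ↦ b)) z
  have h0 : VectorField.lieBracketWithin ℝ (fun _ ↦ a) (fun _ ↦ b) Set.univ z = (0 : E) := by
    simp [VectorField.lieBracket_eq]
  exact (h'.symm.trans h).trans h0

/-- The bracket is natural under pullback by the inverse chart, where both fields become constant,
and the derivative of that map is invertible. This removes the bracket terms from torsion and
curvature. -/
theorem eventually_mlieBracket_coordField {x : M} (u v : TangentSpace (𝓡 n) x) :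
    ∀ᶠ y in 𝓝 x, VectorField.mlieBracket (𝓡 n) (coordField u) (coordField v) y = 0 := by
  have hd : ∀ u : TangentSpace (𝓡 n) x, ∀ᶠ y in 𝓝 x, MDifferentiableAt (𝓡 n)
      ((𝓡 n).prod 𝓘(ℝ, EuclideanSpace ℝ (Fin n)))
      (fun y ↦ (coordField u y : TangentBundle (𝓡 n) M)) y := fun u ↦
    ((contMDiffAt_iff_contMDiffAt_nhds (n := 1) (by simp)).1
      ((contMDiffAt_coordField u).of_le (by simp))).mono
      fun _ h ↦ h.mdifferentiableAt (by simp)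
  have hconst : ∀ u : TangentSpace (𝓡 n) x, ∀ z ∈ (extChartAt (𝓡 n) x).target,
      VectorField.mpullback 𝓘(ℝ, EuclideanSpace ℝ (Fin n)) (𝓡 n) (extChartAt (𝓡 n) x).symm
        (coordField u) z = coordVec u := by
    intro u z hz
    have hinv := isInvertible_mfderivWithin_extChartAt_symm hz
    rw [(𝓡 n).range_eq_univ, mfderivWithin_univ] at hinv
    rw [VectorField.mpullback_apply, coordField_eq_mfderiv u ((extChartAt (𝓡 n) x).map_target hz),
      (extChartAt (𝓡 n) x).right_inv hz]
    exact hinv.inverse_apply_self _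
  have : IsManifold (𝓡 n) (minSmoothness ℝ 2) M := by
    rw [minSmoothness_of_isRCLikeNormedField]
    infer_instance
  filter_upwards [hd u, hd v, extChartAt_source_mem_nhds (I := 𝓡 n) x] with y hu hv hy
  have hz := (extChartAt (𝓡 n) x).map_source hy
  have hl := (extChartAt (𝓡 n) x).left_inv hy
  have h := VectorField.mpullback_mlieBracket (I := 𝓘(ℝ, EuclideanSpace ℝ (Fin n))) (I' := 𝓡 n)
    (f := (extChartAt (𝓡 n) x).symm) (V := coordField u) (W := coordField v)
    (x₀ := extChartAt (𝓡 n) x y) (n := ∞) (by rwa [hl]) (by rwa [hl])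
    (contMDiffAt_extChartAt_symm hz)
    (by rw [minSmoothness_of_isRCLikeNormedField]; exact ENat.LEInfty.out)
  have hev : ∀ u : TangentSpace (𝓡 n) x, VectorField.mpullback 𝓘(ℝ, EuclideanSpace ℝ (Fin n)) (𝓡 n)
      (extChartAt (𝓡 n) x).symm (coordField u) =ᶠ[𝓝 (extChartAt (𝓡 n) x y)]
        fun _ ↦ coordVec u := fun u ↦
    Filter.eventually_of_mem ((isOpen_extChartAt_target x).mem_nhds hz) (hconst u)
  rw [(hev u).mlieBracket_vectorField_eq (hev v), VectorField.mpullback_apply] at h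
  have hinv := isInvertible_mfderivWithin_extChartAt_symm hz
  rw [(𝓡 n).range_eq_univ, mfderivWithin_univ] at hinv
  have h0 := (hinv.inverse_apply_eq).1 (h.trans (mlieBracket_const _ _ _))
  have h1 := h0.trans (map_zero _)
  rw [hl] at h1
  exact h1

end CoordinateFields

/-! ### Derivatives of determinants, and differentiability tested against a frame. -/

section Frames

variable {n : ℕ} {M : Type*} [TopologicalSpace M] [ChartedSpace (EuclideanSpace ℝ (Fin n)) M]

/-- Differentiability of a real function on an `n`-manifold. -/
abbrev FunDiffAt (n : ℕ) {M : Type*} [TopologicalSpace M]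
    [ChartedSpace (EuclideanSpace ℝ (Fin n)) M] (f : M → ℝ) (x : M) : Prop :=
  MDifferentiableAt (𝓡 n) 𝓘(ℝ, ℝ) f x

/-- Differentiability of a vector field. -/
abbrev FieldDiffAt [IsManifold (𝓡 n) ∞ M] (X : ∀ y : M, TangentSpace (𝓡 n) y) (x : M) : Prop :=
  MDifferentiableAt (𝓡 n) ((𝓡 n).prod 𝓘(ℝ, EuclideanSpace ℝ (Fin n)))
    (fun y ↦ (X y : TangentBundle (𝓡 n) M)) x

/-- Smoothness of a vector field. -/
abbrev FieldSmoothAt [IsManifold (𝓡 n) ∞ M] (X : ∀ y : M, TangentSpace (𝓡 n) y) (x : M) : Prop :=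
  ContMDiffAt (𝓡 n) ((𝓡 n).prod 𝓘(ℝ, EuclideanSpace ℝ (Fin n))) ∞
    (fun y ↦ (X y : TangentBundle (𝓡 n) M)) x

theorem mdifferentiableAt_det {m : ℕ} {A : M → Matrix (Fin m) (Fin m) ℝ} {x : M}
    (hA : ∀ i j, FunDiffAt n (fun y ↦ A y i j) x) : FunDiffAt n (fun y ↦ (A y).det) x := by
  have h : (fun y ↦ (A y).det) = ∑ σ : Equiv.Perm (Fin m),
      (fun _ ↦ ((Equiv.Perm.sign σ : ℤ) : ℝ)) * ∏ i, fun y ↦ A y (σ i) i := by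
    ext y
    simp [Matrix.det_apply, Units.smul_def]
  rw [h]
  exact MDifferentiableAt.sum fun σ _ ↦ mdifferentiableAt_const.mul
    (MDifferentiableAt.prod fun i _ ↦ hA _ _)

/-- The determinant is multilinear in the rows, so the product rule differentiates one row at a
time. -/
theorem fderiv_det {E : Type*} [NormedAddCommGroup E] [NormedSpace ℝ E] {m : ℕ}
    {A : E → Matrix (Fin m) (Fin m) ℝ} {z : E} (hA : ∀ i j, DifferentiableAt ℝ (fun y ↦ A y i j) z)
    (v : E) :
    fderiv ℝ (fun y ↦ (A y).det) z v =
      ∑ i, ((A z).updateRow i fun j ↦ fderiv ℝ (fun y ↦ A y i j) z v).det := by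
  -- Rows are taken in `EuclideanSpace` because `toContinuousForm` is stated for inner product
  -- spaces.
  let D : ContinuousMultilinearMap ℝ (fun _ : Fin m ↦ EuclideanSpace ℝ (Fin m)) ℝ :=
    (toContinuousForm (Matrix.detRowAlternating.compLinearMap
      (WithLp.linearEquiv 2 ℝ (Fin m → ℝ)).toLinearMap)).toContinuousMultilinearMap
  let L : E → Fin m → EuclideanSpace ℝ (Fin m) := fun y i ↦ WithLp.toLp 2 (A y i)
  have hD : ∀ B : Fin m → EuclideanSpace ℝ (Fin m), D B = Matrix.det fun i ↦ (B i).ofLp :=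
    fun _ ↦ rfl
  have hL : ∀ i, DifferentiableAt ℝ (fun y ↦ L y i) z := by
    intro i
    rw [differentiableAt_euclidean]
    exact fun j ↦ hA i j
  have hL' : HasFDerivAt L (ContinuousLinearMap.pi fun i ↦ fderiv ℝ (fun y ↦ L y i) z) z :=
    hasFDerivAt_pi.2 fun i ↦ (hL i).hasFDerivAt
  have h := ((D.hasStrictFDerivAt (L z)).hasFDerivAt.comp z hL').fderiv
  have h2 : fderiv ℝ (fun y ↦ (A y).det) z v = D.linearDeriv (L z)
      (fun i ↦ fderiv ℝ (fun y ↦ L y i) z v) := by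
    change fderiv ℝ (D ∘ L) z v = _
    rw [h]
    rfl
  rw [h2, ContinuousMultilinearMap.linearDeriv_apply]
  refine Finset.sum_congr rfl fun i _ ↦ ?_
  rw [hD]
  congr 1
  ext a b
  by_cases h : a = i
  · subst h
    have h' := ((EuclideanSpace.proj (𝕜 := ℝ) b).hasFDerivAt.comp z (hL a).hasFDerivAt).fderiv
    simp only [Function.update_self, Matrix.updateRow_self]
    exact (DFunLike.congr_fun h' v).symm
  · simp [h, L]

theorem mvfderiv_det [IsManifold (𝓡 n) ∞ M] {m : ℕ} {A : M → Matrix (Fin m) (Fin m) ℝ} {x : M}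
    (hA : ∀ i j, FunDiffAt n (fun y ↦ A y i j) x) (v : TangentSpace (𝓡 n) x) :
    mvfderiv (𝓡 n) (fun y ↦ (A y).det) x v =
      ∑ i, ((A x).updateRow i fun j ↦ mvfderiv (𝓡 n) (fun y ↦ A y i j) x v).det := by
  rw [mvfderiv_eq_fderiv (mdifferentiableAt_det hA)]
  have h := fderiv_det (A := fun z ↦ A ((extChartAt (𝓡 n) x).symm z))
    (fun i j ↦ mdifferentiableAt_comp_extChartAt_symm (mem_extChartAt_source x) (hA i j))
    (coordVec v)
  rw [(extChartAt (𝓡 n) x).left_inv (mem_extChartAt_source x)] at h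
  refine h.trans (Finset.sum_congr rfl fun i _ ↦ ?_)
  congr 2
  ext j
  rw [mvfderiv_eq_fderiv (hA i j)]
  rfl

variable [IsManifold (𝓡 n) ∞ M] [RiemannianBundle (fun x : M ↦ TangentSpace (𝓡 n) x)]
  [IsContMDiffRiemannianBundle (𝓡 n) ∞ (EuclideanSpace ℝ (Fin n))
    (fun x : M ↦ TangentSpace (𝓡 n) x)]

/-- A vector field is differentiable if its inner products with a differentiable frame are. -/
theorem mdifferentiableAt_of_inner_frame {x : M} {V : ∀ y : M, TangentSpace (𝓡 n) y}
    {F : Fin n → ∀ y : M, TangentSpace (𝓡 n) y} (hF : ∀ i, FieldDiffAt (F i) x)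
    (hli : LinearIndependent ℝ fun i ↦ F i x)
    (hV : ∀ i, FunDiffAt n (fun y ↦ inner ℝ (V y) (F i y)) x) : FieldDiffAt V x := by
  set G : M → Matrix (Fin n) (Fin n) ℝ := fun y ↦ Matrix.gram ℝ fun i ↦ F i y with hG
  have hGd : ∀ i j, FunDiffAt n (fun y ↦ G y i j) x := fun i j ↦ (hF i).inner_bundle (hF j)
  have hdet : FunDiffAt n (fun y ↦ (G y).det) x := mdifferentiableAt_det hGd
  have hdet0 : (G x).det ≠ 0 := (Matrix.det_gram_ne_zero_iff_linearIndependent).2 hli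
  have hadj : ∀ i j, FunDiffAt n (fun y ↦ (G y).adjugate i j) x := by
    intro i j
    simp_rw [Matrix.adjugate_apply]
    refine mdifferentiableAt_det fun a b ↦ ?_
    by_cases h : a = j
    · subst h
      simp only [Matrix.updateRow_self]
      exact mdifferentiableAt_const
    · simp only [Matrix.updateRow_ne h]
      exact hGd a b
  -- The coefficients of V in the frame: the row of inner products times the inverse Gram matrix,
  -- written as adjugate over determinant so that differentiability is visible.
  let c : Fin n → M → ℝ := fun i y ↦ ∑ j, inner ℝ (V y) (F j y) * ((G y).det⁻¹ * (G y).adjugate j i)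
  have hc : ∀ i, FunDiffAt n (c i) x := by
    intro i
    have : c i = ∑ j, (fun y ↦ inner ℝ (V y) (F j y)) *
        ((fun y ↦ (G y).det⁻¹) * fun y ↦ (G y).adjugate j i) := by
      ext y
      simp [c]
    rw [this]
    exact MDifferentiableAt.sum fun j _ ↦ (hV j).mul ((hdet.inv hdet0).mul (hadj j i))
  have hev : ∀ᶠ y in 𝓝 x, V y = ∑ i, c i y • F i y := by
    filter_upwards [hdet.continuousAt.eventually_ne hdet0] with y hy
    have hliy : LinearIndependent ℝ fun i ↦ F i y :=
      (Matrix.det_gram_ne_zero_iff_linearIndependent).1 hy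
    have hcard : Fintype.card (Fin n) = finrank ℝ (TangentSpace (𝓡 n) y) := by
      rw [Fintype.card_fin, (finrank_tangentSpace y).out]
    refine InnerProductSpace.ext_inner_right_basis (𝕜 := ℝ) (Basis.mk hliy
      (hliy.span_eq_top_of_card_eq_finrank' hcard).ge) fun j ↦ ?_
    have hmul : ((G y)⁻¹ * G y) = 1 := Matrix.nonsing_inv_mul _ (Ne.isUnit hy)
    have hci : ∀ i, c i y = Matrix.vecMul (fun j ↦ inner ℝ (V y) (F j y)) (G y)⁻¹ i := by
      intro i
      simp [c, Matrix.vecMul, dotProduct, Matrix.inv_def, Ring.inverse_eq_inv']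
    have hcG : Matrix.vecMul (fun i ↦ c i y) (G y) = fun j ↦ inner ℝ (V y) (F j y) := by
      rw [funext hci, Matrix.vecMul_vecMul, hmul, Matrix.vecMul_one]
    rw [Basis.mk_apply, sum_inner]
    refine (congrFun hcG j).symm.trans ?_
    simp only [Matrix.vecMul, dotProduct, inner_smul_left]
    rfl
  have hsum : FieldDiffAt (fun y ↦ ∑ i, c i y • F i y) x :=
    MDifferentiableAt.sum_section fun i _ ↦ (hc i).smul_section (hF i)
  refine hsum.congr_of_eventuallyEq ?_
  filter_upwards [hev] with y hy
  rw [hy]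

end Frames

/-! ### The Levi-Civita connection: regularity, Bianchi identity, symmetry of Ricci. -/

section LeviCivita

variable {n : ℕ} {M : Type*} [TopologicalSpace M] [ChartedSpace (EuclideanSpace ℝ (Fin n)) M]
  [IsManifold (𝓡 n) ∞ M]

theorem FieldSmoothAt.fieldDiffAt {X : ∀ y : M, TangentSpace (𝓡 n) y} {x : M}
    (h : FieldSmoothAt X x) : FieldDiffAt X x :=
  h.mdifferentiableAt (by simp)

theorem FieldSmoothAt.eventually_fieldDiffAt {X : ∀ y : M, TangentSpace (𝓡 n) y} {x : M}
    (h : FieldSmoothAt X x) : ∀ᶠ y in 𝓝 x, FieldDiffAt X y :=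
  ((contMDiffAt_iff_contMDiffAt_nhds (n := 1) (by simp)).1 (h.of_le (by simp))).mono
    fun _ h ↦ h.mdifferentiableAt (by simp)

theorem fieldSmoothAt_coordField {x : M} (u : TangentSpace (𝓡 n) x) :
    FieldSmoothAt (coordField u) x := contMDiffAt_coordField u

theorem fieldDiffAt_coordField {x : M} (u : TangentSpace (𝓡 n) x) :
    FieldDiffAt (coordField u) x := FieldSmoothAt.fieldDiffAt (fieldSmoothAt_coordField u)

theorem eventually_fieldDiffAt_coordField {x : M} (u : TangentSpace (𝓡 n) x) :
    ∀ᶠ y in 𝓝 x, FieldDiffAt (coordField u) y :=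
  FieldSmoothAt.eventually_fieldDiffAt (fieldSmoothAt_coordField u)

theorem coordField_self {x : M} (u : TangentSpace (𝓡 n) x) : coordField u x = u :=
  FiberBundle.extend_apply_self _ u

omit [IsManifold (𝓡 n) ∞ M] in
theorem mvfderiv_congr {x : M} {f g : M → ℝ} (h : f =ᶠ[𝓝 x] g) (v : TangentSpace (𝓡 n) x) :
    mvfderiv (𝓡 n) f x v = mvfderiv (𝓡 n) g x v :=
  DFunLike.congr_fun (h.mfderiv_eq (I := 𝓡 n) (I' := 𝓘(ℝ, ℝ))) v

omit [IsManifold (𝓡 n) ∞ M] in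
theorem mvfderiv_const_mul {x : M} {f : M → ℝ} (hf : FunDiffAt n f x) (c : ℝ)
    (v : TangentSpace (𝓡 n) x) :
    mvfderiv (𝓡 n) (fun y ↦ c * f y) x v = c * mvfderiv (𝓡 n) f x v := by
  have h := mvfderiv_mul (I := 𝓡 n) (f := fun _ : M ↦ c) (g := f) mdifferentiableAt_const hf
  rw [mvfderiv_const] at h
  have h' : mvfderiv (𝓡 n) ((fun _ : M ↦ c) * f) x v = c * mvfderiv (𝓡 n) f x v := by
    simpa using DFunLike.congr_fun h v
  exact h'

/-- The rules for a covariant derivative are available only for fields differentiable at the point,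
hence the differentiability hypotheses here and below. -/
theorem connection_congr (nabla : TangentConnection n M) {X Y : ∀ y : M, TangentSpace (𝓡 n) y}
    {x : M} (hX : FieldDiffAt X x) (h : ∀ᶠ y in 𝓝 x, Y y = X y) : nabla Y x = nabla X x := by
  have hY : FieldDiffAt Y x := hX.congr_of_eventuallyEq (h.mono fun y hy ↦ congrArg (TotalSpace.mk y) hy)
  exact nabla.isCovariantDerivativeOnUniv.congr_of_eventuallyEq hY hX Filter.univ_mem h

theorem connection_add (nabla : TangentConnection n M) {X Y : ∀ y : M, TangentSpace (𝓡 n) y}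
    {x : M} (hX : FieldDiffAt X x) (hY : FieldDiffAt Y x) :
    nabla (fun y ↦ X y + Y y) x = nabla X x + nabla Y x :=
  nabla.isCovariantDerivativeOnUniv.add hX hY

theorem torsion_coordField (nabla : TangentConnection n M) {x : M} (u v : TangentSpace (𝓡 n) x) :
    ∀ᶠ y in 𝓝 x, nabla.torsion y (coordField u y) (coordField v y) =
      nabla (coordField v) y (coordField u y) - nabla (coordField u) y (coordField v y) := by
  filter_upwards [eventually_fieldDiffAt_coordField u, eventually_fieldDiffAt_coordField v,
    eventually_mlieBracket_coordField u v] with y hu hv hb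
  rw [nabla.torsion_apply hu hv, hb, sub_zero]

theorem curvature_eq (nabla : TangentConnection n M) {x : M} (u v w : TangentSpace (𝓡 n) x) :
    curvature nabla x u v w =
      nabla (fun y ↦ nabla (coordField w) y (coordField v y)) x u
        - nabla (fun y ↦ nabla (coordField w) y (coordField u y)) x v := by
  rw [curvature, curvatureField, (eventually_mlieBracket_coordField u v).self_of_nhds, map_zero,
    sub_zero, FiberBundle.extend_apply_self, FiberBundle.extend_apply_self]

variable [RiemannianBundle (fun x : M ↦ TangentSpace (𝓡 n) x)]
  [IsContMDiffRiemannianBundle (𝓡 n) ∞ (EuclideanSpace ℝ (Fin n))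
    (fun x : M ↦ TangentSpace (𝓡 n) x)]

theorem FieldDiffAt.inner {X Y : ∀ y : M, TangentSpace (𝓡 n) y} {x : M} (hX : FieldDiffAt X x)
    (hY : FieldDiffAt Y x) : FunDiffAt n (fun y ↦ inner ℝ (X y) (Y y)) x :=
  hX.inner_bundle hY

theorem FieldSmoothAt.inner {X Y : ∀ y : M, TangentSpace (𝓡 n) y} {x : M}
    (hX : FieldSmoothAt X x) (hY : FieldSmoothAt Y x) :
    ContMDiffAt (𝓡 n) 𝓘(ℝ, ℝ) ∞ (fun y ↦ inner ℝ (X y) (Y y)) x :=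
  hX.inner_bundle hY

/-- A vector field is differentiable at `x` if its inner products with the coordinate vector fields
at `x` are. -/
theorem fieldDiffAt_of_inner_coordField {x : M} {V : ∀ y : M, TangentSpace (𝓡 n) y}
    (hV : ∀ w : TangentSpace (𝓡 n) x, FunDiffAt n (fun y ↦ inner ℝ (V y) (coordField w y)) x) :
    FieldDiffAt V x := by
  let b := finBasisOfFinrankEq ℝ (TangentSpace (𝓡 n) x) (finrank_tangentSpace x).out
  refine mdifferentiableAt_of_inner_frame (F := fun i ↦ coordField (b i))
    (fun i ↦ fieldDiffAt_coordField _) ?_ fun i ↦ hV _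
  simp only [coordField_self]
  exact b.linearIndependent

theorem mvfderiv_inner {nabla : TangentConnection n M} (hm : nabla.IsMetricCompatible)
    {X Y : ∀ y : M, TangentSpace (𝓡 n) y} {x : M} (hX : FieldDiffAt X x) (hY : FieldDiffAt Y x)
    (v : TangentSpace (𝓡 n) x) :
    mvfderiv (𝓡 n) (fun y ↦ inner ℝ (X y) (Y y)) x v =
      inner ℝ (nabla X x v) (Y x) + inner ℝ (X x) (nabla Y x v) := by
  have h := hm.mvfderiv_inner_eq (coordField v) hX hY
  simpa only [coordField_self] using h

theorem IsLeviCivita.eventually_symm {nabla : TangentConnection n M} (hG : IsLeviCivita nabla)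
    {x : M} (u v : TangentSpace (𝓡 n) x) :
    ∀ᶠ y in 𝓝 x, nabla (coordField v) y (coordField u y) =
      nabla (coordField u) y (coordField v y) := by
  filter_upwards [torsion_coordField nabla u v] with y hy
  rw [hG.2] at hy
  exact sub_eq_zero.1 (hy.symm.trans rfl)

theorem IsLeviCivita.symm {nabla : TangentConnection n M} (hG : IsLeviCivita nabla)
    {x : M} (u v : TangentSpace (𝓡 n) x) :
    nabla (coordField v) x u = nabla (coordField u) x v := by
  simpa only [coordField_self] using (hG.eventually_symm u v).self_of_nhds

/-- The Koszul formula for coordinate vector fields. -/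
theorem IsLeviCivita.koszul {nabla : TangentConnection n M} (hG : IsLeviCivita nabla)
    {x : M} (u v w : TangentSpace (𝓡 n) x) :
    ∀ᶠ y in 𝓝 x, inner ℝ (nabla (coordField v) y (coordField u y)) (coordField w y) = (1 / 2 : ℝ) *
      (mvfderiv (𝓡 n) (fun z ↦ inner ℝ (coordField v z) (coordField w z)) y (coordField u y)
        + mvfderiv (𝓡 n) (fun z ↦ inner ℝ (coordField u z) (coordField w z)) y (coordField v y)
        - mvfderiv (𝓡 n) (fun z ↦ inner ℝ (coordField u z) (coordField v z)) y
            (coordField w y)) := by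
  filter_upwards [eventually_fieldDiffAt_coordField u, eventually_fieldDiffAt_coordField v,
    eventually_fieldDiffAt_coordField w, hG.eventually_symm u v, hG.eventually_symm u w,
    hG.eventually_symm v w] with y hu hv hw huv huw hvw
  rw [mvfderiv_inner hG.1 hv hw, mvfderiv_inner hG.1 hu hw, mvfderiv_inner hG.1 hu hv,
    ← huv, ← huw, ← hvw, real_inner_comm (coordField v y) (nabla (coordField w) y (coordField u y))]
  ring

/-- By Koszul, the inner products with coordinate fields are first derivatives of smooth metric
coefficients. This is what allows a second covariant derivative to be taken. -/
theorem IsLeviCivita.fieldDiffAt {nabla : TangentConnection n M} (hG : IsLeviCivita nabla)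
    {x : M} (u v : TangentSpace (𝓡 n) x) :
    FieldDiffAt (fun y ↦ nabla (coordField v) y (coordField u y)) x := by
  have hs : ∀ a b c : TangentSpace (𝓡 n) x, FunDiffAt n (fun y ↦
      mvfderiv (𝓡 n) (fun z ↦ inner ℝ (coordField a z) (coordField b z)) y (coordField c y)) x :=
    fun a b c ↦ mdifferentiableAt_mvfderiv_coordField
      ((FieldSmoothAt.inner (fieldSmoothAt_coordField a) (fieldSmoothAt_coordField b)).of_le
        ENat.LEInfty.out) c
  refine fieldDiffAt_of_inner_coordField fun w ↦ ?_
  refine MDifferentiableAt.congr_of_eventuallyEq ?_ (hG.koszul u v w)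
  exact mdifferentiableAt_const.mul (((hs v w u).add (hs u w v)).sub (hs u v w))

/-- For commuting fields ∇_u v = ∇_v u, so the six second derivatives cancel in pairs. -/
theorem IsLeviCivita.bianchi {nabla : TangentConnection n M} (hG : IsLeviCivita nabla)
    {x : M} (u v w : TangentSpace (𝓡 n) x) :
    curvature nabla x u v w + curvature nabla x v w u + curvature nabla x w u v = 0 := by
  rw [curvature_eq, curvature_eq, curvature_eq,
    connection_congr nabla (hG.fieldDiffAt u v) (hG.eventually_symm v u),
    connection_congr nabla (hG.fieldDiffAt u w) (hG.eventually_symm w u),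
    connection_congr nabla (hG.fieldDiffAt v w) (hG.eventually_symm w v)]
  abel

/-- The commutator of two coordinate derivatives of ⟨w, w⟩ is zero and also equals 2⟨R(u, v)w, w⟩,
the terms ⟨∇_v w, ∇_u w⟩ being symmetric. -/
theorem IsLeviCivita.inner_curvature_self {nabla : TangentConnection n M} (hG : IsLeviCivita nabla)
    {x : M} (u v w : TangentSpace (𝓡 n) x) : inner ℝ (curvature nabla x u v w) w = 0 := by
  have hs : ContMDiffAt (𝓡 n) 𝓘(ℝ, ℝ) 2 (fun y ↦ inner ℝ (coordField w y) (coordField w y)) x :=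
    (FieldSmoothAt.inner (fieldSmoothAt_coordField w) (fieldSmoothAt_coordField w)).of_le
        ENat.LEInfty.out
  have key : ∀ u v : TangentSpace (𝓡 n) x,
      mvfderiv (𝓡 n) (fun y ↦ mvfderiv (𝓡 n)
        (fun z ↦ inner ℝ (coordField w z) (coordField w z)) y (coordField v y)) x u =
      2 * (inner ℝ (nabla (fun y ↦ nabla (coordField w) y (coordField v y)) x u) w +
        inner ℝ (nabla (coordField w) x v) (nabla (coordField w) x u)) := by
    intro u v
    have hev : (fun y ↦ mvfderiv (𝓡 n)
        (fun z ↦ inner ℝ (coordField w z) (coordField w z)) y (coordField v y)) =ᶠ[𝓝 x]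
        fun y ↦ 2 * inner ℝ (nabla (coordField w) y (coordField v y)) (coordField w y) := by
      filter_upwards [eventually_fieldDiffAt_coordField w] with y hw
      rw [mvfderiv_inner hG.1 hw hw, real_inner_comm (coordField w y)]
      ring
    rw [mvfderiv_congr hev, mvfderiv_const_mul
        (FieldDiffAt.inner (hG.fieldDiffAt v w) (fieldDiffAt_coordField w)),
      mvfderiv_inner hG.1 (hG.fieldDiffAt v w) (fieldDiffAt_coordField w), coordField_self,
      coordField_self]
  have h := mvfderiv_mvfderiv_coordField_comm hs u v
  rw [key, key] at h
  rw [curvature_eq, inner_sub_left]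
  rw [real_inner_comm (nabla (coordField w) x u)] at h
  linarith

/-- Symmetry holds summand by summand: in the Bianchi identity for e, u, v paired with e, the term
⟨R(u, v)e, e⟩ vanishes. -/
theorem IsLeviCivita.ricci_symm {nabla : TangentConnection n M} (hG : IsLeviCivita nabla)
    {x : M} (u v : TangentSpace (𝓡 n) x) : ricci nabla x u v = ricci nabla x v u := by
  refine Finset.sum_congr rfl fun i _ ↦ ?_
  set e := stdOrthonormalBasis ℝ (TangentSpace (𝓡 n) x) i
  have h := congrArg (fun z ↦ inner ℝ z e) (hG.bianchi e u v)
  simp only [inner_add_left, hG.inner_curvature_self, inner_zero_left] at h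
  have hsk : curvature nabla x v e u = -curvature nabla x e v u := by
    rw [curvature_eq, curvature_eq, neg_sub]
  rw [hsk, inner_neg_left] at h
  linarith

end LeviCivita

/-! ### Sign rules for two- and three-forms. -/

section ThreeForms

variable {V : Type*} [NormedAddCommGroup V] [InnerProductSpace ℝ V]

theorem twoForm_swap (α : V [⋀^Fin 2]→L[ℝ] ℝ) (u v : V) : α ![u, v] = -α ![v, u] := by
  have h := α.toAlternatingMap.map_swap ![v, u] (i := 0) (j := 1) (by decide)
  rwa [show (![v, u] ∘ (Equiv.swap 0 1 : Equiv.Perm (Fin 2))) = ![u, v] by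
    ext a; fin_cases a <;> rfl] at h

theorem threeForm_swap_left (α : V [⋀^Fin 3]→L[ℝ] ℝ) (u v w : V) :
    α ![u, v, w] = -α ![v, u, w] := by
  have h := α.toAlternatingMap.map_swap ![v, u, w] (i := 0) (j := 1) (by decide)
  rwa [show (![v, u, w] ∘ (Equiv.swap 0 1 : Equiv.Perm (Fin 3))) = ![u, v, w] by
    ext a; fin_cases a <;> rfl] at h

theorem threeForm_swap_right (α : V [⋀^Fin 3]→L[ℝ] ℝ) (u v w : V) :
    α ![u, v, w] = -α ![u, w, v] := by
  have h := α.toAlternatingMap.map_swap ![u, w, v] (i := 1) (j := 2) (by decide)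
  rwa [show (![u, w, v] ∘ (Equiv.swap 1 2 : Equiv.Perm (Fin 3))) = ![u, v, w] by
    ext a; fin_cases a <;> rfl] at h

theorem threeForm_self (α : V [⋀^Fin 3]→L[ℝ] ℝ) (u v : V) : α ![u, v, u] = 0 :=
  α.map_eq_zero_of_eq ![u, v, u] (i := 0) (j := 2) rfl (by decide)

end ThreeForms

/-! ### The contorsion tensor and the Ricci tensor in terms of H. -/

section Contorsion

variable {n : ℕ} {M : Type*} [TopologicalSpace M] [ChartedSpace (EuclideanSpace ℝ (Fin n)) M]
  [IsManifold (𝓡 n) ∞ M]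

/-- The difference tensor of two connections: `contorsion nabla nabla' y w v` is
`∇_v W - ∇'_v W` for every vector field `W` with value `w` at `y`. -/
def contorsion (nabla nabla' : TangentConnection n M) (y : M) :
    TangentSpace (𝓡 n) y →L[ℝ] TangentSpace (𝓡 n) y →L[ℝ] TangentSpace (𝓡 n) y :=
  nabla.difference nabla' y

theorem connection_eq_add_contorsion (nabla nabla' : TangentConnection n M)
    {W : ∀ y : M, TangentSpace (𝓡 n) y} {y : M} (hW : FieldDiffAt W y)
    (v : TangentSpace (𝓡 n) y) :
    nabla W y v = nabla' W y v + contorsion nabla nabla' y (W y) v := by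
  have h := nabla.isCovariantDerivativeOnUniv.difference_apply
    nabla'.isCovariantDerivativeOnUniv (x := y) (hσ := hW)
  have h' := DFunLike.congr_fun h v
  rw [contorsion, CovariantDerivative.difference, h']
  simp

theorem IsSmoothForm.contMDiffAt_three {H : DiffForm n M 3} (hH : IsSmoothForm H) {x : M}
    {U V W : ∀ y : M, TangentSpace (𝓡 n) y}
    (hU : FieldSmoothAt U x) (hV : FieldSmoothAt V x) (hW : FieldSmoothAt W x) :
    ContMDiffAt (𝓡 n) 𝓘(ℝ, ℝ) ∞ (fun y ↦ H y ![U y, V y, W y]) x := by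
  have h := hH x ![U, V, W] (by intro i; fin_cases i <;> assumption)
  convert h using 3 with y
  ext i
  fin_cases i <;> rfl

theorem IsSmoothForm.funDiffAt_three {H : DiffForm n M 3} (hH : IsSmoothForm H) {x : M}
    {U V W : ∀ y : M, TangentSpace (𝓡 n) y}
    (hU : FieldSmoothAt U x) (hV : FieldSmoothAt V x) (hW : FieldSmoothAt W x) :
    FunDiffAt n (fun y ↦ H y ![U y, V y, W y]) x :=
  (hH.contMDiffAt_three hU hV hW).mdifferentiableAt (by simp)

variable [RiemannianBundle (fun x : M ↦ TangentSpace (𝓡 n) x)]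
  [IsContMDiffRiemannianBundle (𝓡 n) ∞ (EuclideanSpace ℝ (Fin n))
    (fun x : M ↦ TangentSpace (𝓡 n) x)]

variable {nabla nablaG : TangentConnection n M} {H : DiffForm n M 3}

/-- Metricity of both connections makes the difference tensor skew in its last two arguments, and
the torsion gives its antisymmetrisation in the first two. As in Koszul's formula, these determine
it. -/
theorem inner_contorsion (hG : IsLeviCivita nablaG) (hnabla : HasSkewTorsion nabla H) (x : M)
    (u v w : TangentSpace (𝓡 n) x) :
    inner ℝ (contorsion nabla nablaG x v u) w = 1 / 2 * H x ![u, v, w] := by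
  have hd : ∀ u v : TangentSpace (𝓡 n) x, nabla (coordField v) x u =
      nablaG (coordField v) x u + contorsion nabla nablaG x v u := fun u v ↦ by
    have h := connection_eq_add_contorsion nabla nablaG (fieldDiffAt_coordField v) u
    rwa [coordField_self] at h
  have hskew : ∀ u v w : TangentSpace (𝓡 n) x, inner ℝ (contorsion nabla nablaG x v u) w =
      -inner ℝ (contorsion nabla nablaG x w u) v := by
    intro u v w
    have h1 := mvfderiv_inner hG.1 (fieldDiffAt_coordField v) (fieldDiffAt_coordField w) u
    have h2 := mvfderiv_inner hnabla.1 (fieldDiffAt_coordField v) (fieldDiffAt_coordField w) u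
    rw [h1, hd, hd, inner_add_left, inner_add_right, coordField_self, coordField_self,
      real_inner_comm (contorsion nabla nablaG x w u)] at h2
    linarith
  have htor : ∀ u v w : TangentSpace (𝓡 n) x, inner ℝ (contorsion nabla nablaG x v u) w -
      inner ℝ (contorsion nabla nablaG x u v) w = H x ![u, v, w] := by
    intro u v w
    have h1 := (torsion_coordField nabla u v).self_of_nhds
    rw [coordField_self, coordField_self] at h1
    rw [← hnabla.2, h1, hd, hd, hG.symm u v, ← inner_sub_left]
    congr 1
    abel
  have h1 := htor u v w
  have h2 := htor v w u
  have h3 := htor u w v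
  have e1 := hskew u v w
  have e2 := hskew v u w
  have e3 := hskew w v u
  have p1 := threeForm_swap_left (H x) v w u
  have p2 := threeForm_swap_right (H x) u w v
  have p3 := threeForm_swap_right (H x) w v u
  have p4 := threeForm_swap_left (H x) w u v
  linarith

theorem fieldDiffAt_contorsion (hG : IsLeviCivita nablaG) (hnabla : HasSkewTorsion nabla H)
    (hH : IsSmoothForm H) {x : M} (u v : TangentSpace (𝓡 n) x) :
    FieldDiffAt (fun y ↦ contorsion nabla nablaG y (coordField v y) (coordField u y)) x := by
  refine fieldDiffAt_of_inner_coordField fun w ↦ ?_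
  simp_rw [inner_contorsion hG hnabla]
  exact mdifferentiableAt_const.mul (hH.funDiffAt_three (fieldSmoothAt_coordField u)
    (fieldSmoothAt_coordField v) (fieldSmoothAt_coordField w))

/-- The covariant derivative `(∇_u H)(v, w, z)` of a `3`-form. -/
def covDerivThreeForm (nabla : TangentConnection n M) (H : DiffForm n M 3) (x : M)
    (u v w z : TangentSpace (𝓡 n) x) : ℝ :=
  mvfderiv (𝓡 n) (fun y ↦ H y ![coordField v y, coordField w y, coordField z y]) x u
    - H x ![nabla (coordField v) x u, w, z] - H x ![v, nabla (coordField w) x u, z]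
    - H x ![v, w, nabla (coordField z) x u]

theorem connection_connection_eq (hG : IsLeviCivita nablaG) (hnabla : HasSkewTorsion nabla H)
    (hH : IsSmoothForm H) {x : M} (u v w : TangentSpace (𝓡 n) x) :
    nabla (fun y ↦ nabla (coordField w) y (coordField v y)) x u =
      nablaG (fun y ↦ nablaG (coordField w) y (coordField v y)) x u +
      nablaG (fun y ↦ contorsion nabla nablaG y (coordField w y) (coordField v y)) x u +
      contorsion nabla nablaG x (nablaG (coordField w) x v) u +
      contorsion nabla nablaG x (contorsion nabla nablaG x w v) u := by
  have hP := hG.fieldDiffAt v w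
  have hQ := fieldDiffAt_contorsion hG hnabla hH v w
  have hPQ : FieldDiffAt (fun y ↦ nablaG (coordField w) y (coordField v y) +
      contorsion nabla nablaG y (coordField w y) (coordField v y)) x :=
    mdifferentiableAt_add_section hP hQ
  have hev : ∀ᶠ y in 𝓝 x, nabla (coordField w) y (coordField v y) =
      nablaG (coordField w) y (coordField v y) +
      contorsion nabla nablaG y (coordField w y) (coordField v y) := by
    filter_upwards [eventually_fieldDiffAt_coordField w] with y hw
    exact connection_eq_add_contorsion nabla nablaG hw _
  rw [connection_congr nabla hPQ hev, connection_eq_add_contorsion nabla nablaG hPQ u,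
    connection_add nablaG hP hQ, map_add]
  simp only [coordField_self, add_apply]
  abel

/-- Only the components needed for the trace are computed. Repeating u kills ⟨A_u A_v w, u⟩ and (∇_v
H)(u, w, u), both being values of a three-form with a repeated argument. -/
theorem inner_curvature_eq (hG : IsLeviCivita nablaG) (hnabla : HasSkewTorsion nabla H)
    (hH : IsSmoothForm H) {x : M} (u v w : TangentSpace (𝓡 n) x) :
    inner ℝ (curvature nabla x u v w) u = inner ℝ (curvature nablaG x u v w) u +
      1 / 2 * covDerivThreeForm nablaG H x u v w u -
      inner ℝ (contorsion nabla nablaG x (contorsion nabla nablaG x w u) v) u := by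
  have hderiv : ∀ a b c d : TangentSpace (𝓡 n) x, inner ℝ
      (nablaG (fun y ↦ contorsion nabla nablaG y (coordField b y) (coordField a y)) x d) c =
      1 / 2 * (mvfderiv (𝓡 n) (fun y ↦ H y ![coordField a y, coordField b y, coordField c y]) x d
        - H x ![a, b, nablaG (coordField c) x d]) := by
    intro a b c d
    have h := mvfderiv_inner hG.1 (fieldDiffAt_contorsion hG hnabla hH a b)
      (fieldDiffAt_coordField c) d
    simp_rw [inner_contorsion hG hnabla, coordField_self] at h
    rw [mvfderiv_const_mul (hH.funDiffAt_three (fieldSmoothAt_coordField a)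
      (fieldSmoothAt_coordField b) (fieldSmoothAt_coordField c))] at h
    linarith
  -- Needed for the derivative along v of H(u, w, u), which vanishes identically.
  have hzero : mvfderiv (𝓡 n)
      (fun _ : M ↦ (0 : ℝ)) x v = 0 := by
    rw [mvfderiv_const]
    rfl
  rw [curvature_eq, curvature_eq, connection_connection_eq hG hnabla hH,
    connection_connection_eq hG hnabla hH]
  simp only [inner_sub_left, inner_add_left, hderiv, inner_contorsion hG hnabla, hzero,
    threeForm_self]
  -- The surviving term H(u, w, ∇_v u) supplies the correction −H(∇_u v, w, u), since the connection
  -- is torsion-free.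
  rw [covDerivThreeForm, hG.symm v u]
  have p1 := threeForm_swap_left (H x) u w (nablaG (coordField v) x u)
  have p2 := threeForm_swap_right (H x) w u (nablaG (coordField v) x u)
  have p3 := threeForm_swap_left (H x) w (nablaG (coordField v) x u) u
  linarith

/-- The quadratic term comes from moving the skew operator A_u across the inner product and
expanding ⟨A_u e_i, A_{e_i} v⟩ in the orthonormal basis. -/
theorem ricci_eq (hG : IsLeviCivita nablaG) (hnabla : HasSkewTorsion nabla H)
    (hH : IsSmoothForm H) {x : M} (u v : TangentSpace (𝓡 n) x) :
    ricci nabla x u v = ricci nablaG x u v +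
      1 / 2 * ∑ i, covDerivThreeForm nablaG H x (stdOrthonormalBasis ℝ (TangentSpace (𝓡 n) x) i)
        u v (stdOrthonormalBasis ℝ (TangentSpace (𝓡 n) x) i) -
      1 / 4 * ∑ i, ∑ j,
        H x ![u, stdOrthonormalBasis ℝ (TangentSpace (𝓡 n) x) i,
          stdOrthonormalBasis ℝ (TangentSpace (𝓡 n) x) j] *
        H x ![v, stdOrthonormalBasis ℝ (TangentSpace (𝓡 n) x) i,
          stdOrthonormalBasis ℝ (TangentSpace (𝓡 n) x) j] := by
  rw [ricci, ricci, Finset.mul_sum, Finset.mul_sum, ← Finset.sum_add_distrib,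
    ← Finset.sum_sub_distrib]
  refine Finset.sum_congr rfl fun i _ ↦ ?_
  rw [inner_curvature_eq hG hnabla hH]
  congr 1
  set b := stdOrthonormalBasis ℝ (TangentSpace (𝓡 n) x)
  set A := contorsion nabla nablaG x
  have h1 : inner ℝ (A (A v (b i)) u) (b i) = -inner ℝ (A (b i) u) (A v (b i)) := by
    rw [inner_contorsion hG hnabla, inner_contorsion hG hnabla, threeForm_swap_right]
    ring
  rw [h1, ← b.sum_inner_mul_inner, Finset.mul_sum, ← Finset.sum_neg_distrib]
  refine Finset.sum_congr rfl fun j _ ↦ ?_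
  rw [real_inner_comm (A v (b i)), inner_contorsion hG hnabla, inner_contorsion hG hnabla,
    threeForm_swap_left (H x) (b i) v]
  ring

end Contorsion

/-- Both sides are the trace of adj(A) N. It reconciles derivatives of W_j, which enter det ⟨V_i,
W_j⟩ by columns, with a product rule by rows. -/
theorem sum_det_updateRow {m : ℕ} (A N : Matrix (Fin m) (Fin m) ℝ) :
    ∑ i, (A.updateRow i (N i)).det = ∑ j, (A.updateCol j fun i ↦ N i j).det := by
  have h1 : ∀ i, (A.updateRow i (N i)).det = ∑ j, A.adjugate j i * N i j := fun i ↦ by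
    rw [← Matrix.cramer_transpose_apply, Matrix.cramer_eq_adjugate_mulVec,
      ← Matrix.adjugate_transpose]
    rfl
  have h2 : ∀ j, (A.updateCol j fun i ↦ N i j).det = ∑ i, A.adjugate j i * N i j := fun j ↦ by
    rw [← Matrix.cramer_apply, Matrix.cramer_eq_adjugate_mulVec]
    rfl
  simp_rw [h1, h2]
  exact Finset.sum_comm

/-! ### The volume form and determinants of inner products. -/

section VolumeForm

variable {V : Type*} [NormedAddCommGroup V] [InnerProductSpace ℝ V] {n : ℕ}
  [Fact (finrank ℝ V = n)] [FiniteDimensional ℝ V]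

theorem exists_volumeForm_eq_det (o : Orientation ℝ V (Fin n)) :
    ∃ (e : OrthonormalBasis (Fin n) ℝ V) (σ : ℝ), σ * σ = 1 ∧
      ∀ v : Fin n → V, o.volumeForm v = σ * e.toBasis.det v := by
  let e : OrthonormalBasis (Fin n) ℝ V := (stdOrthonormalBasis ℝ V).reindex (finCongr Fact.out)
  by_cases h : e.toBasis.orientation = o
  · exact ⟨e, 1, by simp, fun v ↦ by rw [o.volumeForm_robust e h]; simp⟩
  · refine ⟨e, -1, by simp, fun v ↦ ?_⟩
    rw [o.volumeForm_robust_neg e h]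
    simp

/-- The matrix of inner products factors through coordinate matrices, and the orientation sign is
squared away. Products of volumes thus depend only on the metric. -/
theorem volumeForm_mul_volumeForm (o : Orientation ℝ V (Fin n)) (v w : Fin n → V) :
    o.volumeForm v * o.volumeForm w = (Matrix.of fun i j ↦ inner ℝ (v i) (w j)).det := by
  obtain ⟨e, σ, hσ, h⟩ := exists_volumeForm_eq_det o
  have hm : (Matrix.of fun i j ↦ inner ℝ (v i) (w j)) =
      (e.toBasis.toMatrix v).transpose * e.toBasis.toMatrix w := by
    ext i j
    simp only [Matrix.of_apply, Matrix.mul_apply, Matrix.transpose_apply, Basis.toMatrix_apply,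
      OrthonormalBasis.coe_toBasis_repr_apply, OrthonormalBasis.repr_apply_apply]
    rw [← e.sum_inner_mul_inner]
    exact Finset.sum_congr rfl fun k _ ↦ by rw [real_inner_comm (e k) (v i)]
  rw [h, h, hm, Matrix.det_mul, Matrix.det_transpose, Basis.det_apply, Basis.det_apply]
  linear_combination (e.toBasis.toMatrix v).det * (e.toBasis.toMatrix w).det * hσ

theorem volumeForm_pos_of_orientation_eq {o : Orientation ℝ V (Fin n)}
    (b : Basis (Fin n) ℝ V) (hb : b.orientation = o) : 0 < o.volumeForm b := by
  let e : OrthonormalBasis (Fin n) ℝ V := (stdOrthonormalBasis ℝ V).reindex (finCongr Fact.out)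
  by_cases h : e.toBasis.orientation = o
  · rw [o.volumeForm_robust e h]
    exact (e.toBasis.orientation_eq_iff_det_pos b).1 (h.trans hb.symm)
  · rw [o.volumeForm_robust_neg e h]
    have h1 : ¬ 0 < e.toBasis.det b := fun h' ↦
      h (((e.toBasis.orientation_eq_iff_det_pos b).2 h').trans hb)
    have h2 : e.toBasis.det b ≠ 0 := (e.toBasis.isUnit_det b).ne_zero
    simpa using lt_of_le_of_ne (not_lt.1 h1) h2

end VolumeForm

theorem mvfderiv_mul_apply {n : ℕ} {M : Type*} [TopologicalSpace M]
    [ChartedSpace (EuclideanSpace ℝ (Fin n)) M] {x : M} {f g : M → ℝ} (hf : FunDiffAt n f x)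
    (hg : FunDiffAt n g x) (u : TangentSpace (𝓡 n) x) :
    mvfderiv (𝓡 n) (fun y ↦ f y * g y) x u =
      mvfderiv (𝓡 n) f x u * g x + f x * mvfderiv (𝓡 n) g x u := by
  have h := DFunLike.congr_fun (mvfderiv_mul (I := 𝓡 n) hf hg) u
  have h' : mvfderiv (𝓡 n) (f * g) x u =
      mvfderiv (𝓡 n) f x u * g x + f x * mvfderiv (𝓡 n) g x u := by
    simpa [mul_comm, add_comm] using h
  exact h'

/-! ### Differentiability and parallelism of the volume form. -/

section ParallelVolume

variable {n : ℕ} {M : Type*} [TopologicalSpace M] [ChartedSpace (EuclideanSpace ℝ (Fin n)) M]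
  [IsManifold (𝓡 n) ∞ M] [RiemannianBundle (fun x : M ↦ TangentSpace (𝓡 n) x)]
  [IsContMDiffRiemannianBundle (𝓡 n) ∞ (EuclideanSpace ℝ (Fin n))
    (fun x : M ↦ TangentSpace (𝓡 n) x)]
  {o : ∀ x : M, Orientation ℝ (TangentSpace (𝓡 n) x) (Fin n)} {nabla : TangentConnection n M}

/-- On an oriented frame the volume is positive, hence the square root of the Gram determinant,
hence differentiable. The local coherence of `o` enters here. -/
theorem IsManifoldOrientation.exists_frame (ho : IsManifoldOrientation o) (x : M) :
    ∃ F : Fin n → ∀ y : M, TangentSpace (𝓡 n) y, (∀ i, FieldSmoothAt (F i) x) ∧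
      (∀ᶠ y in 𝓝 x, ∃ b : Basis (Fin n) ℝ (TangentSpace (𝓡 n) y), ∀ i, b i = F i y) ∧
      (∀ᶠ y in 𝓝 x, 0 < (o y).volumeForm fun i ↦ F i y) ∧
      FunDiffAt n (fun y ↦ (o y).volumeForm fun i ↦ F i y) x := by
  obtain ⟨F, hF, hb⟩ := ho x
  have hpos : ∀ᶠ y in 𝓝 x, 0 < (o y).volumeForm fun i ↦ F i y := by
    filter_upwards [hb] with y ⟨b, hbF, hbo⟩
    rw [← funext hbF]
    exact volumeForm_pos_of_orientation_eq b hbo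
  have hFd : ∀ i, FieldDiffAt (F i) x := fun i ↦ FieldSmoothAt.fieldDiffAt (hF i)
  refine ⟨F, hF, hb.mono fun y ⟨b, h, _⟩ ↦ ⟨b, h⟩, hpos, ?_⟩
  have hdet : FunDiffAt n
      (fun y ↦ (Matrix.of fun i j ↦ inner ℝ (F i y) (F j y) : Matrix (Fin n) (Fin n) ℝ).det) x :=
    mdifferentiableAt_det fun i j ↦ FieldDiffAt.inner (hFd i) (hFd j)
  have hne : (Matrix.of fun i j ↦ inner ℝ (F i x) (F j x) : Matrix (Fin n) (Fin n) ℝ).det ≠ 0 := by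
    rw [← volumeForm_mul_volumeForm (o x)]
    have := hpos.self_of_nhds
    positivity
  have hs : FunDiffAt n (fun y ↦ √(Matrix.of fun i j ↦ inner ℝ (F i y) (F j y) :
      Matrix (Fin n) (Fin n) ℝ).det) x :=
    MDifferentiableAt.comp (I' := 𝓘(ℝ, ℝ)) x
      (Real.hasDerivAt_sqrt hne).differentiableAt.mdifferentiableAt hdet
  refine hs.congr_of_eventuallyEq ?_
  filter_upwards [hpos] with y hy
  rw [← volumeForm_mul_volumeForm (o y), Real.sqrt_mul_self hy.le]

/-- For an oriented frame F, vol(V) = det ⟨V_i, F_j⟩ / vol(F). -/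
theorem IsManifoldOrientation.funDiffAt_volumeForm (ho : IsManifoldOrientation o) {x : M}
    {V : Fin n → ∀ y : M, TangentSpace (𝓡 n) y} (hV : ∀ i, FieldDiffAt (V i) x) :
    FunDiffAt n (fun y ↦ (o y).volumeForm fun i ↦ V i y) x := by
  obtain ⟨F, hF, -, hpos, hs⟩ := ho.exists_frame x
  have hdet : FunDiffAt n
      (fun y ↦ (Matrix.of fun i j ↦ inner ℝ (V i y) (F j y) : Matrix (Fin n) (Fin n) ℝ).det) x :=
    mdifferentiableAt_det fun i j ↦ FieldDiffAt.inner (hV i) (FieldSmoothAt.fieldDiffAt (hF j))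
  refine (hdet.mul (hs.inv hpos.self_of_nhds.ne')).congr_of_eventuallyEq ?_
  filter_upwards [hpos] with y hy
  exact (eq_mul_inv_iff_mul_eq₀ hy.ne').2 (volumeForm_mul_volumeForm (o y) _ _)

theorem mvfderiv_volumeForm_mul_volumeForm (hm : nabla.IsMetricCompatible) {x : M}
    {V W : Fin n → ∀ y : M, TangentSpace (𝓡 n) y} (hV : ∀ i, FieldDiffAt (V i) x)
    (hW : ∀ i, FieldDiffAt (W i) x) (u : TangentSpace (𝓡 n) x) :
    mvfderiv (𝓡 n) (fun y ↦ ((o y).volumeForm fun i ↦ V i y) * (o y).volumeForm fun i ↦ W i y) x u =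
      (∑ i, (o x).volumeForm (Function.update (fun i ↦ V i x) i (nabla (V i) x u))) *
        ((o x).volumeForm fun i ↦ W i x) +
      ((o x).volumeForm fun i ↦ V i x) *
        ∑ i, (o x).volumeForm (Function.update (fun i ↦ W i x) i (nabla (W i) x u)) := by
  simp_rw [volumeForm_mul_volumeForm, Finset.sum_mul, Finset.mul_sum, volumeForm_mul_volumeForm]
  rw [mvfderiv_det (A := fun y ↦ Matrix.of fun i j ↦ inner ℝ (V i y) (W j y))
    fun i j ↦ FieldDiffAt.inner (hV i) (hW j)]
  set A : Matrix (Fin n) (Fin n) ℝ := Matrix.of fun i j ↦ inner ℝ (V i x) (W j x) with hA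
  have h1 : ∀ i, (Matrix.of fun a j ↦ inner ℝ
      (Function.update (fun i ↦ V i x) i (nabla (V i) x u) a) (W j x)) =
      A.updateRow i fun j ↦ inner ℝ (nabla (V i) x u) (W j x) := by
    intro i
    ext a j
    by_cases h : a = i
    · subst h; simp
    · simp [h, hA]
  have h2 : ∀ j, (Matrix.of fun i a ↦ inner ℝ (V i x)
      (Function.update (fun i ↦ W i x) j (nabla (W j) x u) a)) =
      A.updateCol j fun i ↦ inner ℝ (V i x) (nabla (W j) x u) := by
    intro j
    ext i a
    by_cases h : a = j
    · subst h; simp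
    · simp [h, hA]
  simp_rw [h1, h2]
  rw [← sum_det_updateRow A fun i j ↦ inner ℝ (V i x) (nabla (W j) x u),
    ← Finset.sum_add_distrib]
  refine Finset.sum_congr rfl fun i _ ↦ ?_
  rw [← Matrix.det_updateRow_add]
  congr 2
  ext j
  exact mvfderiv_inner hm (hV i) (hW j) u

/-- The volume form of an oriented Riemannian manifold is parallel for every metric connection. -/
theorem mvfderiv_volumeForm (ho : IsManifoldOrientation o) (hm : nabla.IsMetricCompatible) {x : M}
    {V : Fin n → ∀ y : M, TangentSpace (𝓡 n) y} (hV : ∀ i, FieldDiffAt (V i) x)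
    (u : TangentSpace (𝓡 n) x) :
    mvfderiv (𝓡 n) (fun y ↦ (o y).volumeForm fun i ↦ V i y) x u =
      ∑ i, (o x).volumeForm (Function.update (fun i ↦ V i x) i (nabla (V i) x u)) := by
  obtain ⟨F, hF, -, hpos, hs⟩ := ho.exists_frame x
  have hx := hpos.self_of_nhds
  replace hF := fun i ↦ FieldSmoothAt.fieldDiffAt (hF i)
  -- Differentiating vol(F)² gives the claim for F, as vol(F) ≠ 0; differentiating vol(V) vol(F)
  -- then gives it for V.
  have h1 := mvfderiv_volumeForm_mul_volumeForm (o := o) hm hF hF u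
  rw [mvfderiv_mul_apply hs hs] at h1
  have h2 := mvfderiv_volumeForm_mul_volumeForm (o := o) hm hV hF u
  rw [mvfderiv_mul_apply (ho.funDiffAt_volumeForm hV) hs] at h2
  refine mul_right_cancel₀ hx.ne' ?_
  have h3 : mvfderiv (𝓡 n) (fun y ↦ (o y).volumeForm fun i ↦ F i y) x u =
      ∑ i, (o x).volumeForm (Function.update (fun i ↦ F i x) i (nabla (F i) x u)) := by
    refine mul_right_cancel₀ hx.ne' ?_
    linarith
  rw [h3] at h2
  linarith

end ParallelVolume

theorem map_update_basis {V ι : Type*} [AddCommGroup V] [Module ℝ V] [Fintype ι] [DecidableEq ι]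
    (b : Basis ι ℝ V) (μ : V [⋀^ι]→ₗ[ℝ] ℝ) (v : V) (i : ι) :
    μ (Function.update b i v) = b.repr v i * μ b := by
  conv_lhs => rw [← b.sum_repr v]
  rw [AlternatingMap.map_update_sum, Finset.sum_eq_single i]
  · simp
  · intro j _ hj
    rw [AlternatingMap.map_update_smul, AlternatingMap.map_update_self _ _ hj.symm, smul_zero]
  · simp

/-! ### The exterior derivative of a one-form on coordinate fields. -/

section OneForms

variable {n : ℕ} {M : Type*} [TopologicalSpace M] [ChartedSpace (EuclideanSpace ℝ (Fin n)) M]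
  [IsManifold (𝓡 n) ∞ M]

theorem exists_coordVec_eq {x : M} (a : EuclideanSpace ℝ (Fin n)) :
    ∃ u : TangentSpace (𝓡 n) x, coordVec u = a :=
  ⟨(trivializationAt (EuclideanSpace ℝ (Fin n)) (TangentSpace (𝓡 n)) x).symm x a, by
    rw [coordVec, Trivialization.apply_mk_symm _ (FiberBundle.mem_baseSet_trivializationAt' x)]⟩

theorem chartForm_oneForm_coordVec (η : DiffForm n M 1) {x : M} (u : TangentSpace (𝓡 n) x)
    {z : EuclideanSpace ℝ (Fin n)} (hz : z ∈ (extChartAt (𝓡 n) x).target) :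
    chartForm η x z ![coordVec u] =
      ((fun y ↦ η y ![coordField u y]) ∘ (extChartAt (𝓡 n) x).symm) z := by
  have h := coordField_eq_mfderiv u ((extChartAt (𝓡 n) x).map_target hz)
  rw [(extChartAt (𝓡 n) x).right_inv hz] at h
  rw [Function.comp_apply, h, chartForm]
  refine congrArg (η ((extChartAt (𝓡 n) x).symm z)) ?_
  ext1 i
  fin_cases i
  rfl

theorem eventually_chartForm_oneForm (η : DiffForm n M 1) {x : M} (u : TangentSpace (𝓡 n) x) :
    (fun z ↦ chartForm η x z ![coordVec u]) =ᶠ[𝓝 (extChartAt (𝓡 n) x x)]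
      (fun y ↦ η y ![coordField u y]) ∘ (extChartAt (𝓡 n) x).symm := by
  filter_upwards [extChartAt_target_mem_nhds (I := 𝓡 n) x] with z hz
  exact chartForm_oneForm_coordVec η u hz

theorem differentiableAt_oneForm {E : Type*} [NormedAddCommGroup E] [NormedSpace ℝ E]
    [FiniteDimensional ℝ E] {f : E → E [⋀^Fin 1]→L[ℝ] ℝ} {z : E}
    (hf : ∀ a, DifferentiableAt ℝ (fun y ↦ f y ![a]) z) : DifferentiableAt ℝ f z := by
  let b := finBasis ℝ E
  have h : f = fun y ↦ ∑ i, f y ![b i] •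
      ContinuousAlternatingMap.ofSubsingleton ℝ E ℝ (0 : Fin 1) (b.coord i).toContinuousLinearMap := by
    funext y
    obtain ⟨g, hg⟩ := (ContinuousAlternatingMap.ofSubsingleton ℝ E ℝ (0 : Fin 1)).surjective (f y)
    rw [← hg]
    ext v
    have hv := congrArg g (b.sum_repr (v 0))
    rw [map_sum] at hv
    simp [← hv, mul_comm]
  rw [h]
  exact DifferentiableAt.fun_sum fun i _ ↦ (hf (b i)).smul_const _

/-- `dη(U, V) = U(η(V)) - V(η(U))` for commuting fields. -/
theorem extDerivForm_oneForm_apply {η : DiffForm n M 1} {x : M}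
    (hη : ∀ u : TangentSpace (𝓡 n) x, FunDiffAt n (fun y ↦ η y ![coordField u y]) x)
    (u v : TangentSpace (𝓡 n) x) :
    extDerivForm η x ![u, v] = mvfderiv (𝓡 n) (fun y ↦ η y ![coordField v y]) x u -
      mvfderiv (𝓡 n) (fun y ↦ η y ![coordField u y]) x v := by
  have hd : DifferentiableAt ℝ (chartForm η x) (extChartAt (𝓡 n) x x) := by
    refine differentiableAt_oneForm fun a ↦ ?_
    obtain ⟨w, rfl⟩ := exists_coordVec_eq (x := x) a
    exact (mdifferentiableAt_comp_extChartAt_symm (mem_extChartAt_source x)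
      (hη w)).congr_of_eventuallyEq (eventually_chartForm_oneForm η w)
  have hvec : (mfderiv (𝓡 n) 𝓘(ℝ, EuclideanSpace ℝ (Fin n)) (extChartAt (𝓡 n) x) x) ∘ ![u, v] =
      ![coordVec u, coordVec v] := by
    ext1 i
    fin_cases i
    · exact mfderiv_extChartAt_eq_coordVec u
    · exact mfderiv_extChartAt_eq_coordVec v
  have h := extDeriv_apply hd ![coordVec u, coordVec v]
  have h0 : (0 : Fin 2).removeNth ![coordVec u, coordVec v] = ![coordVec v] := by
    ext1 i; fin_cases i; rfl
  have h1 : (1 : Fin 2).removeNth ![coordVec u, coordVec v] = ![coordVec u] := by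
    ext1 i; fin_cases i; rfl
  rw [Fin.sum_univ_two, h0, h1, (eventually_chartForm_oneForm η v).fderiv_eq,
    (eventually_chartForm_oneForm η u).fderiv_eq] at h
  rw [mvfderiv_eq_fderiv (hη v), mvfderiv_eq_fderiv (hη u)]
  refine (congrArg (extDeriv (chartForm η x) (extChartAt (𝓡 n) x x)) hvec).trans (h.trans ?_)
  simp [sub_eq_add_neg]

end OneForms

/-! ### The torsion one-form in dimension four, and the Ricci formula. -/

section TorsionForm

variable {M : Type*} [TopologicalSpace M] [ChartedSpace (EuclideanSpace ℝ (Fin 4)) M]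
  [IsManifold (𝓡 4) ∞ M] [RiemannianBundle (fun x : M ↦ TangentSpace (𝓡 4) x)]
  [IsContMDiffRiemannianBundle (𝓡 4) ∞ (EuclideanSpace ℝ (Fin 4))
    (fun x : M ↦ TangentSpace (𝓡 4) x)]
  {o : ∀ x : M, Orientation ℝ (TangentSpace (𝓡 4) x) (Fin 4)} {H : DiffForm 4 M 3}
  {nablaG : TangentConnection 4 M}

/-- The vector field `B` with `H = -ι_B vol` is differentiable if `H` is smooth. -/
theorem fieldDiffAt_of_eq_neg_volumeForm (ho : IsManifoldOrientation o) (hH : IsSmoothForm H)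
    {B : ∀ y : M, TangentSpace (𝓡 4) y}
    (hB : ∀ y u v w, H y ![u, v, w] = -(o y).volumeForm ![B y, u, v, w]) (x : M) :
    FieldDiffAt B x := by
  obtain ⟨F, hF, hspan, hpos, hs⟩ := ho.exists_frame x
  have hT : ∀ i j k, FunDiffAt 4 (fun y ↦ H y ![F i y, F j y, F k y]) x := fun i j k ↦
    hH.funDiffAt_three (hF i) (hF j) (hF k)
  -- Cramer's rule: the F_i-coefficient of B is vol(F with B in slot i) / vol(F), and the numerator
  -- is, up to sign, H on the other three frame fields.
  have hupd : ∀ i, FunDiffAt 4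
      (fun y ↦ (o y).volumeForm (Function.update (fun j ↦ F j y) i (B y))) x := by
    have hzero : ∀ y, (o y).volumeForm (Function.update (fun j ↦ F j y) 0 (B y)) =
        -1 * H y ![F 1 y, F 2 y, F 3 y] := fun y ↦ by
      rw [hB, neg_one_mul, neg_neg]
      congr 1
      ext1 a
      fin_cases a <;> rfl
    -- For i ≠ 0, swapping B into slot 0 costs a sign that cancels the minus in `hB`.
    have hswap : ∀ (y : M) (i j k l : Fin 4), i ≠ 0 →
        Function.update (fun j ↦ F j y) i (B y) ∘ Equiv.swap i 0 =
          ![B y, F j y, F k y, F l y] →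
        (o y).volumeForm (Function.update (fun j ↦ F j y) i (B y)) =
          H y ![F j y, F k y, F l y] := fun y i j k l hi h ↦ by
      rw [hB, ← h, AlternatingMap.map_swap _ _ hi, neg_neg]
    intro i
    fin_cases i
    · exact (funext hzero) ▸ mdifferentiableAt_const.mul (hT 1 2 3)
    · exact (funext fun y ↦ hswap y 1 0 2 3 (by decide) (by ext1 a; fin_cases a <;> rfl)) ▸ hT 0 2 3
    · exact (funext fun y ↦ hswap y 2 1 0 3 (by decide) (by ext1 a; fin_cases a <;> rfl)) ▸ hT 1 0 3
    · exact (funext fun y ↦ hswap y 3 1 2 0 (by decide) (by ext1 a; fin_cases a <;> rfl)) ▸ hT 1 2 0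
  have hsum : FieldDiffAt (fun y ↦ ∑ i, ((o y).volumeForm (Function.update (fun j ↦ F j y) i (B y)) *
      ((o y).volumeForm fun j ↦ F j y)⁻¹) • F i y) x :=
    MDifferentiableAt.sum_section fun i _ ↦ ((hupd i).mul
      (hs.inv hpos.self_of_nhds.ne')).smul_section (FieldSmoothAt.fieldDiffAt (hF i))
  have hev : ∀ᶠ y in 𝓝 x, B y = ∑ i,
      ((o y).volumeForm (Function.update (fun j ↦ F j y) i (B y)) *
        ((o y).volumeForm fun j ↦ F j y)⁻¹) • F i y := by
    filter_upwards [hpos, hspan] with y hy ⟨b, hb⟩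
    rw [← funext hb] at hy ⊢
    conv_lhs => rw [← b.sum_repr (B y)]
    refine Finset.sum_congr rfl fun i _ ↦ ?_
    rw [map_update_basis, mul_inv_cancel_right₀ hy.ne', hb]
  exact hsum.congr_of_eventuallyEq (hev.mono fun y hy ↦ congrArg (TotalSpace.mk y) hy)

/-- Since vol is parallel, the derivative falls on B alone; the other three Leibniz terms cancel the
corrections in `covDerivThreeForm`. -/
theorem covDerivThreeForm_eq_neg_volumeForm (ho : IsManifoldOrientation o) (hH : IsSmoothForm H)
    (hm : nablaG.IsMetricCompatible) {B : ∀ y : M, TangentSpace (𝓡 4) y}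
    (hB : ∀ y u v w, H y ![u, v, w] = -(o y).volumeForm ![B y, u, v, w]) {x : M}
    (u v w z : TangentSpace (𝓡 4) x) :
    covDerivThreeForm nablaG H x u v w z = -(o x).volumeForm ![nablaG B x u, v, w, z] := by
  have hV : ∀ i, FieldDiffAt ((![B, coordField v, coordField w, coordField z] :
      Fin 4 → ∀ y : M, TangentSpace (𝓡 4) y) i) x := by
    intro i
    fin_cases i
    · exact fieldDiffAt_of_eq_neg_volumeForm ho hH hB x
    · exact fieldDiffAt_coordField v
    · exact fieldDiffAt_coordField w
    · exact fieldDiffAt_coordField z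
  have hvec : ∀ y, (fun i ↦ (![B, coordField v, coordField w, coordField z] :
      Fin 4 → ∀ y : M, TangentSpace (𝓡 4) y) i y) =
      ![B y, coordField v y, coordField w y, coordField z y] := fun y ↦ by
    ext1 i
    fin_cases i <;> rfl
  have h := mvfderiv_volumeForm ho hm hV u
  simp_rw [hvec] at h
  have h2 : mvfderiv (𝓡 4) (fun y ↦ H y ![coordField v y, coordField w y, coordField z y]) x u =
      -1 * mvfderiv (𝓡 4) (fun y ↦ (o y).volumeForm
        ![B y, coordField v y, coordField w y, coordField z y]) x u := by
    have hd := ho.funDiffAt_volumeForm hV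
    simp_rw [hvec] at hd
    rw [← mvfderiv_const_mul hd]
    simp_rw [hB, neg_one_mul]
  rw [covDerivThreeForm, h2, h, hB, hB, hB, Fin.sum_univ_four]
  simp only [coordField_self]
  have u0 : Function.update ![B x, v, w, z] 0 (nablaG B x u) = ![nablaG B x u, v, w, z] := by
    ext1 i; fin_cases i <;> rfl
  have u1 : Function.update ![B x, v, w, z] 1 (nablaG (coordField v) x u) =
      ![B x, nablaG (coordField v) x u, w, z] := by
    ext1 i; fin_cases i <;> rfl
  have u2 : Function.update ![B x, v, w, z] 2 (nablaG (coordField w) x u) =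
      ![B x, v, nablaG (coordField w) x u, z] := by
    ext1 i; fin_cases i <;> rfl
  have u3 : Function.update ![B x, v, w, z] 3 (nablaG (coordField z) x u) =
      ![B x, v, w, nablaG (coordField z) x u] := by
    ext1 i; fin_cases i <;> rfl
  change -1 * ((o x).volumeForm (Function.update ![B x, v, w, z] 0 (nablaG B x u)) +
    (o x).volumeForm (Function.update ![B x, v, w, z] 1 (nablaG (coordField v) x u)) +
    (o x).volumeForm (Function.update ![B x, v, w, z] 2 (nablaG (coordField w) x u)) +
    (o x).volumeForm (Function.update ![B x, v, w, z] 3 (nablaG (coordField z) x u))) - _ - _ - _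
      = _
  rw [u0, u1, u2, u3]
  ring

/-- Here h = ⟨B, ·⟩, and the terms ⟨B, ∇_u v⟩ and ⟨B, ∇_v u⟩ cancel by torsion-freeness. -/
theorem extDerivForm_torsionOneForm_apply (ho : IsManifoldOrientation o) (hH : IsSmoothForm H)
    (hG : IsLeviCivita nablaG) {B : ∀ y : M, TangentSpace (𝓡 4) y}
    (hB : ∀ y u v w, H y ![u, v, w] = -(o y).volumeForm ![B y, u, v, w]) {x : M}
    (u v : TangentSpace (𝓡 4) x) :
    extDerivForm (torsionOneForm o H) x ![u, v] =
      inner ℝ (nablaG B x u) v - inner ℝ (nablaG B x v) u := by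
  have hBd := fieldDiffAt_of_eq_neg_volumeForm ho hH hB x
  have hval : ∀ w : TangentSpace (𝓡 4) x,
      (fun y ↦ torsionOneForm o H y ![coordField w y]) = fun y ↦ inner ℝ (B y) (coordField w y) :=
    fun w ↦ funext fun y ↦ hodgeStar_neg_volumeForm (o y) (hB y) _
  have hd : ∀ w : TangentSpace (𝓡 4) x,
      FunDiffAt 4 (fun y ↦ torsionOneForm o H y ![coordField w y]) x := fun w ↦ by
    rw [hval]
    exact FieldDiffAt.inner hBd (fieldDiffAt_coordField w)
  rw [extDerivForm_oneForm_apply hd, hval, hval,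
    mvfderiv_inner hG.1 hBd (fieldDiffAt_coordField v),
    mvfderiv_inner hG.1 hBd (fieldDiffAt_coordField u), coordField_self, coordField_self,
    hG.symm u v]
  ring

theorem ricci_eq_of_hasSkewTorsion (ho : IsManifoldOrientation o) (hH : IsSmoothForm H)
    (hG : IsLeviCivita nablaG) {nabla : TangentConnection 4 M} (hnabla : HasSkewTorsion nabla H)
    {x : M} (u v : TangentSpace (𝓡 4) x) :
    ricci nabla x u v = ricci nablaG x u v
      - 1 / 2 * oneFormNormSq (torsionOneForm o H x) * inner ℝ u v
      + 1 / 2 * (torsionOneForm o H x ![u] * torsionOneForm o H x ![v])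
      + 1 / 2 * starTwoForm o (extDerivForm (torsionOneForm o H)) x ![u, v] := by
  -- B is chosen point by point; its differentiability is recovered from H by
  -- `fieldDiffAt_of_eq_neg_volumeForm`.
  choose B hB using fun y ↦ exists_eq_neg_volumeForm (o y) (H y)
  have hval : ∀ w : TangentSpace (𝓡 4) x, torsionOneForm o H x ![w] = inner ℝ (B x) w :=
    hodgeStar_neg_volumeForm (o x) (hB x)
  have hstar : starTwoForm o (extDerivForm (torsionOneForm o H)) x ![u, v] = _ :=
    hodgeStar_antisymmetrization (o x) (nablaG B x)
      (fun u v ↦ extDerivForm_torsionOneForm_apply ho hH hG hB u v) u v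
  rw [ricci_eq hG hnabla hH, sum_threeForm_mul_threeForm (o x) (hB x), oneFormNormSq_eq hval,
    hval, hval, hstar]
  simp_rw [covDerivThreeForm_eq_neg_volumeForm ho hH hG.1 hB]
  rw [Finset.sum_neg_distrib]
  ring

end TorsionForm

end SkewTorsion

end

theorem mainTheorem9 {M : Type*} [TopologicalSpace M] [ChartedSpace (EuclideanSpace ℝ (Fin 4)) M]
    [IsManifold (𝓡 4) ∞ M]
    [RiemannianBundle (fun x : M ↦ TangentSpace (𝓡 4) x)]
    [IsContMDiffRiemannianBundle (𝓡 4) ∞ (EuclideanSpace ℝ (Fin 4))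
      (fun x : M ↦ TangentSpace (𝓡 4) x)]
    (o : ∀ x : M, Orientation ℝ (TangentSpace (𝓡 4) x) (Fin 4))
    (ho : SkewTorsion.IsManifoldOrientation o)
    (H : SkewTorsion.DiffForm 4 M 3) (hH : SkewTorsion.IsSmoothForm H)
    (nablaG : SkewTorsion.TangentConnection 4 M) (hG : SkewTorsion.IsLeviCivita nablaG)
    (nabla : SkewTorsion.TangentConnection 4 M) (hnabla : SkewTorsion.HasSkewTorsion nabla H)
    (h : SkewTorsion.DiffForm 4 M 1) (hh : h = SkewTorsion.torsionOneForm o H)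
    (x : M) (X Y : TangentSpace (𝓡 4) x) :
    SkewTorsion.ricci nabla x X Y =
        SkewTorsion.ricci nablaG x X Y - 1 / 2 * SkewTorsion.oneFormNormSq (h x) * inner ℝ X Y
          + 1 / 2 * (h x ![X] * h x ![Y])
          + 1 / 2 * SkewTorsion.starTwoForm o (SkewTorsion.extDerivForm h) x ![X, Y] ∧
    SkewTorsion.ricci nabla x Y X =
        SkewTorsion.ricci nablaG x X Y - 1 / 2 * SkewTorsion.oneFormNormSq (h x) * inner ℝ X Y
          + 1 / 2 * (h x ![X] * h x ![Y])
          - 1 / 2 * SkewTorsion.starTwoForm o (SkewTorsion.extDerivForm h) x ![X, Y] := by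
  subst hh
  have h1 := SkewTorsion.ricci_eq_of_hasSkewTorsion ho hH hG hnabla X Y
  have h2 := SkewTorsion.ricci_eq_of_hasSkewTorsion ho hH hG hnabla Y X
  have h3 := SkewTorsion.twoForm_swap (SkewTorsion.starTwoForm o
    (SkewTorsion.extDerivForm (SkewTorsion.torsionOneForm o H)) x) Y X
  refine ⟨h1, ?_⟩
  rw [h2, h3, hG.ricci_symm Y X, real_inner_comm X Y]
  ring
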